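/- A \emph{generalized triangulation} of a closed surface $X$ is a presentation of $X$ as the quotient of a finite disjoint union of triangles whose sides are identified in pairs (loops, multiple edges and triangles with two sides glued together are allowed); $V=\{v_1,\dots,v_N\}$, $E$, $F$ denote the resulting finite sets of vertices, edges and triangles, and $\chi(X)=|V|-|E|+|F|$. A \emph{weight} is a function $\Phi:E\to[0,\pi/2]$, and a \emph{circle packing metric} is a positive function $r=(r_1,\dots,r_N)\in\mathbb{R}^N_{>0}$ on $V$. Given $r$, each edge $ij$ receives the length $$l_{ij}=\cosh^{-1}\bigl(\cosh r_i\cosh r_j+\sinh r_i\sinh r_j\cos\Phi_{ij}\bigr),$$ and each triangle $ijk$ is regarded as the hyperbolic triangle with these side lengths; $\theta_i^{jk}$ is its inner angle at $i$, and $\mathrm{Area}(\triangle v_iv_jv_k)$ its area, i.e. $\pi$ minus the sum of its inner angles. Put $$K_i=2\pi-\sum_{\{ijk\}\in F}\theta_i^{jk},\qquad B_{ij}=\frac{\partial(\theta_i^{jk}+\theta_i^{jl})}{\partial r_j}\sinh r_j,\qquad A_i=\sinh r_i\,\frac{\partial}{\partial r_i}\Bigl(\sum_{\{ijk\}\in F}\mathrm{Area}(\triangle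 v_iv_jv_k)\Bigr),$$ where $ijk$ and $ijl$ are the two triangles adjacent to the edge $ij$, and $$\Delta_pK_i=\sum_{j\sim i}B_{ij}|K_j-K_i|^{p-2}(K_j-K_i),$$ where a summand with $K_j=K_i$ is $0$. (Sums over the triangles or edges at a vertex are taken with multiplicity: $K_i$ sums over all triangle corners at $i$, and $\Delta_p$ over all edge ends at $i$. In $B_{ij}$ the angles of each triangle are differentiated as functions of independent radii at its three corners; in $A_i$ the total area is differentiated as a function of $r\in\mathbb{R}^N_{>0}$.) \textbf{Theorem.} Let $(\mathcal{T},\Phi)$ be a weighted generalized triangulation of a closed connected surface $X$ of negative Euler characteristic, and let $p>1$. For every initial circle packing metric $r(0)\in\mathbb{R}^N_{>0}$, the combinatorial $p$-th Calabi flow in hyperbolic background geometry $$\frac{dr_i}{dt}=(\Delta_pK_i-A_iK_i)\sinh r_i,\qquad i=1,\dots,N,$$ has a solution $r(t)\in\mathbb{R}^N_{>0}$ with the given initial value for all $t\in[0,+\infty)$, and this solution is unique: every solution in $\mathbb{R}^N_{>0}$ with the same initial value on an interval $[0,b)$, $b>0$, agrees with it there. Moreover, $r(t)$ converges, as $t\to+\infty$,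 to a point of $\mathbb{R}^N_{>0}$ if and only if there exists a circle packing metric $r_{ze}\in\mathbb{R}^N_{>0}$ with zero curvature, i.e. with $K_i(r_{ze})=0$ for all $i$. -/

import Mathlib

noncomputable section

namespace CirclePacking

/-- A generalized triangulation (loops, multiple edges and self-glued triangles are allowed) of a
closed surface, with finite sets `V`, `E`, `F` of vertices, edges and triangles: the surface is the
quotient of the disjoint union of the triangles `F`, whose sides are glued together in pairs.

A triangle has corners `0, 1, 2 : Fin 3`; its side `a` is the one opposite to the corner `a`, so it
joins the corners `a + 1` and `a + 2`. Every edge has two ends, labelled by `Bool`. -/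
structure Triangulation (V E F : Type*) [Fintype F] [DecidableEq E] where
  /-- the vertex at a corner of a triangle -/
  vert : F → Fin 3 → V
  /-- the edge carried by a side of a triangle -/
  edge : F → Fin 3 → E
  /-- the two end points of an edge -/
  ends : E → Bool → V
  /-- which end of the edge sits at the corner `a + 1` of the side `a` of a triangle
  (the other end sits at `a + 2`) -/
  side : F → Fin 3 → Bool
  /-- every edge arises by gluing exactly two sides -/
  card_edge : ∀ e, (Finset.univ.filter fun s : F × Fin 3 => edge s.1 s.2 = e).card = 2
  vert_succ : ∀ f a, vert f (a + 1) = ends (edge f a) (side f a)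
  vert_succ_succ : ∀ f a, vert f (a + 2) = ends (edge f a) (!side f a)
  /-- every vertex is the vertex at some corner -/
  vert_surj : ∀ v, ∃ f a, vert f a = v
  /-- two corners give the same vertex only if the gluing of the sides forces it: the equivalence
  relation on corners is generated by identifying corners at the same end of the same edge -/
  vert_glue : ∀ c c' : F × Fin 3, vert c.1 c.2 = vert c'.1 c'.2 →
    Relation.EqvGen (fun d d' : F × Fin 3 => ∃ (a a' : Fin 3) (ε : Bool),
      edge d.1 a = edge d'.1 a' ∧
      d.2 = (if side d.1 a = ε then a + 1 else a + 2) ∧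
      d'.2 = (if side d'.1 a' = ε then a' + 1 else a' + 2)) c c'

/-- The edge length in hyperbolic background geometry, for circles of radii `x`, `y` meeting with
the weight `φ`. -/
def hypLength (φ x y : ℝ) : ℝ :=
  Real.arcosh (Real.cosh x * Real.cosh y + Real.sinh x * Real.sinh y * Real.cos φ)

/-- The inner angle opposite to the side `a` in a hyperbolic triangle with side lengths
`a`, `b`, `c` (hyperbolic law of cosines). -/
def hypAngle (a b c : ℝ) : ℝ :=
  Real.arccos ((Real.cosh b * Real.cosh c - Real.cosh a) / (Real.sinh b * Real.sinh c))

/-- The length of the side opposite to the corner `a` in the hyperbolic triangle formed by three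
circles of radii `ρ`, where `φ b` is the weight of the side opposite to the corner `b`. -/
def sideLength (φ ρ : Fin 3 → ℝ) (a : Fin 3) : ℝ :=
  hypLength (φ a) (ρ (a + 1)) (ρ (a + 2))

/-- The inner angle at the corner `a` of that triangle. -/
def cornerAngle (φ ρ : Fin 3 → ℝ) (a : Fin 3) : ℝ :=
  hypAngle (sideLength φ ρ a) (sideLength φ ρ (a + 1)) (sideLength φ ρ (a + 2))

/-- The area of that triangle, i.e. its angle defect (Gauss-Bonnet in curvature `-1`). -/
def triangleArea (φ ρ : Fin 3 → ℝ) : ℝ :=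
  Real.pi - ∑ a : Fin 3, cornerAngle φ ρ a

namespace Triangulation

variable {V E F : Type*} [Fintype V] [Fintype E] [Fintype F] [DecidableEq V] [DecidableEq E]

/-- The surface is connected: it is non-empty, and any two triangles are joined by a chain of
triangles in which consecutive ones share an edge. -/
def Connected (T : Triangulation V E F) : Prop :=
  Nonempty F ∧
    ∀ f g : F, Relation.ReflTransGen (fun f g : F => ∃ a b, T.edge f a = T.edge g b) f g

/-- The Euler characteristic `|V| - |E| + |F|` of the surface. -/
def eulerChar (_T : Triangulation V E F) : ℤ :=
  (Fintype.card V : ℤ) - Fintype.card E + Fintype.card F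

/-- The corner of the triangle `f` at which the end `ε` of its side `a` sits. -/
def corner (T : Triangulation V E F) (f : F) (a : Fin 3) (ε : Bool) : Fin 3 :=
  if T.side f a = ε then a + 1 else a + 2

/-- The combinatorial Gauss curvature: `2π` minus the sum of all inner angles at the vertex `i`. -/
def curvature (T : Triangulation V E F) (Φ : E → ℝ) (r : V → ℝ) (i : V) : ℝ :=
  2 * Real.pi - ∑ c : F × Fin 3 with T.vert c.1 c.2 = i,
    cornerAngle (fun b => Φ (T.edge c.1 b)) (fun b => r (T.vert c.1 b)) c.2

/-- The coefficient `B_{ij} = ∂(θ_i^{jk} + θ_i^{jl})/∂r_j · sinh r_j` of the edge `e = ij`, where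
`i` is its end `ε` and `j` its other end; the sum is over the two sides glued along `e`. In each
triangle the angle is differentiated as a function of the radii at its three corners. -/
def edgeCoeff (T : Triangulation V E F) (Φ : E → ℝ) (r : V → ℝ) (e : E) (ε : Bool) : ℝ :=
  ∑ s : F × Fin 3 with T.edge s.1 s.2 = e,
    deriv (fun x => cornerAngle (fun b => Φ (T.edge s.1 b))
        (Function.update (fun b => r (T.vert s.1 b)) (T.corner s.1 s.2 !ε) x)
        (T.corner s.1 s.2 ε)) (r (T.ends e !ε)) *
      Real.sinh (r (T.ends e !ε))

/-- The discrete `p`-Laplace operator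
`Δ_p g_i = ∑_{j ∼ i} B_{ij} |g_j - g_i| ^ (p - 2) (g_j - g_i)`; the sum is over all edges at `i`
(an edge with both ends at `i` contributes `0`). -/
def pLaplacian (T : Triangulation V E F) (Φ : E → ℝ) (p : ℝ) (r : V → ℝ) (g : V → ℝ) (i : V) : ℝ :=
  ∑ d : E × Bool with T.ends d.1 d.2 = i,
    T.edgeCoeff Φ r d.1 d.2 * |g (T.ends d.1 !d.2) - g i| ^ (p - 2) * (g (T.ends d.1 !d.2) - g i)

/-- `A_i = sinh r_i · ∂/∂r_i (∑ Area)`. The sum may be taken over all triangles, since the area of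
a triangle without vertex `i` does not depend on `r_i`. -/
def areaCoeff (T : Triangulation V E F) (Φ : E → ℝ) (r : V → ℝ) (i : V) : ℝ :=
  Real.sinh (r i) * deriv (fun x => ∑ f : F,
    triangleArea (fun b => Φ (T.edge f b)) (fun b => Function.update r i x (T.vert f b))) (r i)

/-- `r` is a solution on the time set `s` (an interval starting at `0`) of the combinatorial `p`-th
Calabi flow `dr_i/dt = (Δ_p K_i - A_i K_i) sinh r_i` in hyperbolic background geometry; it consists
of circle packing metrics, i.e. of positive functions on the vertices. The derivative at time `0`
is one-sided. -/
def IsCalabiFlow (T : Triangulation V E F) (Φ : E → ℝ) (p : ℝ) (s : Set ℝ) (r : ℝ → V → ℝ) : Prop :=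
  ∀ t ∈ s, ∀ i : V, 0 < r t i ∧
    HasDerivWithinAt (fun τ => r τ i)
      ((T.pLaplacian Φ p (r t) (T.curvature Φ (r t)) i
        - T.areaCoeff Φ (r t) i * T.curvature Φ (r t) i) * Real.sinh (r t i)) s t

end Triangulation

end CirclePacking

end

/-!
In the logarithmic coordinates `u = log (tanh (r / 2)) < 0` one has `dr = sinh r du`, and the Calabi
flow becomes an equation `u' = Δ_p K - A K` on an open orthant. The law of cosines gives, for a
triangle and each of its sides, the derivative of the angle at one end of the side with respect to
`u` at the other end as a coefficient `sideCoeff` that is symmetric in the two ends; the derivative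
of the area is given by the products `sideCoeff * (cosh l - 1)`, where `l` is the length of the side
(`hasFDerivAt_cornerAngle`, `hasDerivAt_triangleArea`). For weights in `[0, π / 2]` the coefficients
are nonnegative, and at each corner at least one of the two sides ending there has a positive one
(`sideCoeff_nonneg`, `sideCoeff_pos_or`). Hence the sides of the triangles form a weighted graph on
the vertices, with weights `β ≥ 0` and ratios `ξ = cosh l - 1 > 0`, such that, with sums over the
sides `ij` at `i`,
* `(dK w)ᵢ = ∑ β (ξ wᵢ + (wᵢ - wⱼ))`,
* the flow is `uᵢ' = -∑ β (ξ Kᵢ + φ (Kᵢ - Kⱼ))` with the increasing function `φ x = |x| ^ (p - 2) x`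
  (`velocity_curvatureSystem`).

So `dK` is symmetric and positive definite, `K` is the gradient of a strictly convex potential `E`,
and the rest of the argument uses only this structure, which is called `CurvatureSystem`.

*Existence.* Solutions exist locally by Peano's theorem (`φ` is not Lipschitz if `p < 2`). If a
radius is large, then the angles at its centre are small and the sides ending there are long, so
that its curvature is at least `1` and `ξ Kᵢ` dominates the bounded term `φ`; thus large circles
shrink (`exists_velocity_nonpos`). Away from `u = 0` the coefficients are bounded, hence so is the
velocity, and solutions exist for all times (`exists_solution_Ici`); small radii do not reach `0` in
finite time, since this corresponds to `u = -∞`.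

*Uniqueness.* Along two solutions `u`, `v` the function `⟪K u - K v, u - v⟫`, comparable with
`‖u - v‖²`, satisfies a Gronwall inequality, since by the symmetry of `dK` the term with `φ` enters
with the sign given by its monotonicity (`solution_unique`).

*Convergence.* At a limit the velocity vanishes, and pairing it with `K` gives `K = 0`. Conversely
let `K y = 0`. Then `y` is the minimum of the convex potential `E`, which grows linearly at infinity
and decreases along the flow. The solution therefore stays in a compact set, where the dissipation
`⟪K, flux K⟫` is bounded below by a multiple of `E - E y`; so `E - E y` decays exponentially, and
the solution tends to `y` (`tendsto_of_K_eq_zero`).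
-/

noncomputable section

/-! ### Derivatives and bounds of the inner angles of a hyperbolic triangle -/

namespace CirclePacking
open Real

/-- The hyperbolic cosine of the length of the side opposite to the corner `a`. -/
def sideCosh (φ ρ : Fin 3 → ℝ) (a : Fin 3) : ℝ :=
  cosh (ρ (a + 1)) * cosh (ρ (a + 2)) + sinh (ρ (a + 1)) * sinh (ρ (a + 2)) * cos (φ a)

/-- The Gram-type determinant `1 + 2 x₀ x₁ x₂ - x₀² - x₁² - x₂²` of the hyperbolic cosines of the
side lengths of a triangle. -/
def gramDet (x y z : ℝ) : ℝ := 1 + 2 * x * y * z - x ^ 2 - y ^ 2 - z ^ 2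

theorem gramDet_rotate (x y z : ℝ) : gramDet y z x = gramDet x y z := by
  unfold gramDet; ring

/-- The Gram determinant in terms of the hyperbolic sines and cosines of the radii and the cosines
`a`, `b`, `d` of the weights. If the latter are nonnegative, then so are all terms of the sum. -/
theorem gramDet_expand {c₁ c₂ c₃ s₁ s₂ s₃ a b d : ℝ}
    (h₁ : c₁ ^ 2 = s₁ ^ 2 + 1) (h₂ : c₂ ^ 2 = s₂ ^ 2 + 1) (h₃ : c₃ ^ 2 = s₃ ^ 2 + 1) :
    gramDet (c₂ * c₃ + s₂ * s₃ * a) (c₃ * c₁ + s₃ * s₁ * b) (c₁ * c₂ + s₁ * s₂ * d) =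
      s₁ ^ 2 * s₂ ^ 2 * (1 - d ^ 2) + s₂ ^ 2 * s₃ ^ 2 * (1 - a ^ 2)
      + s₁ ^ 2 * s₃ ^ 2 * (1 - b ^ 2) + 2 * s₁ ^ 2 * s₂ ^ 2 * s₃ ^ 2 * (1 + a * b * d)
      + 2 * (c₂ * c₃ * s₁ ^ 2 * s₂ * s₃ * (a + b * d) + c₁ * c₃ * s₁ * s₃ * s₂ ^ 2 * (b + a * d)
        + c₁ * c₂ * s₁ * s₂ * s₃ ^ 2 * (d + a * b)) := by
  unfold gramDet
  grind

/-- The numerator of the derivative of an inner angle with respect to the radius at another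
corner, as a polynomial in the hyperbolic cosines of the radii and of the sides. -/
def coeffNum (c₁ c₂ c₃ x₁ x₂ x₃ : ℝ) : ℝ :=
  c₁ * (1 - x₁ ^ 2) + c₂ * (x₂ * x₁ - x₃) + c₃ * (x₃ * x₁ - x₂)

/-- For nonnegative `a`, `b`, `d` the numerator is nonnegative. -/
theorem coeffNum_expand {c₁ c₂ c₃ s₁ s₂ s₃ a b d : ℝ}
    (h₂ : c₂ ^ 2 = s₂ ^ 2 + 1) (h₃ : c₃ ^ 2 = s₃ ^ 2 + 1) :
    coeffNum c₁ c₂ c₃ (c₂ * c₃ + s₂ * s₃ * a) (c₃ * c₁ + s₃ * s₁ * b) (c₁ * c₂ + s₁ * s₂ * d) =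
      s₂ * s₃ * (c₁ * s₂ * s₃ * (1 - a ^ 2) + c₂ * s₃ * s₁ * (d + a * b)
        + c₃ * s₂ * s₁ * (b + a * d)) := by
  unfold coeffNum
  grind

section generic

variable {G : Type*} [NormedAddCommGroup G] [NormedSpace ℝ G]

/-- The differential of an inner angle of a hyperbolic triangle as a function of the hyperbolic
cosines of its sides. -/
theorem hasFDerivAt_hypAngle_arcosh {x y z : G → ℝ} {x' y' z' : G →L[ℝ] ℝ} {e : G}
    (hx : HasFDerivAt x x' e) (hy : HasFDerivAt y y' e) (hz : HasFDerivAt z z' e)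
    (hx1 : 1 < x e) (hy1 : 1 < y e) (hz1 : 1 < z e) (hD : 0 < gramDet (x e) (y e) (z e)) :
    HasFDerivAt (fun t => hypAngle (arcosh (x t)) (arcosh (y t)) (arcosh (z t)))
      ((√(gramDet (x e) (y e) (z e)))⁻¹ •
        (x' - ((x e * y e - z e) / (y e ^ 2 - 1)) • y' - ((x e * z e - y e) / (z e ^ 2 - 1)) • z'))
      e := by
  have hev : (fun t => hypAngle (arcosh (x t)) (arcosh (y t)) (arcosh (z t))) =ᶠ[nhds e]
      fun t => arccos ((y t * z t - x t) / (√(y t ^ 2 - 1) * √(z t ^ 2 - 1))) := by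
    filter_upwards [hx.continuousAt.eventually (lt_mem_nhds hx1),
      hy.continuousAt.eventually (lt_mem_nhds hy1),
      hz.continuousAt.eventually (lt_mem_nhds hz1)] with t h1 h2 h3
    rw [hypAngle, cosh_arcosh h1.le, cosh_arcosh h2.le, cosh_arcosh h3.le, sinh_arcosh h2.le,
      sinh_arcosh h3.le]
  refine HasFDerivAt.congr_of_eventuallyEq ?_ hev
  have hy2 : 0 < y e ^ 2 - 1 := by nlinarith
  have hz2 : 0 < z e ^ 2 - 1 := by nlinarith
  have hp : HasFDerivAt (fun t => √(y t ^ 2 - 1)) _ e :=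
    ((hy.pow 2).sub_const 1).sqrt hy2.ne'
  have hq : HasFDerivAt (fun t => √(z t ^ 2 - 1)) _ e :=
    ((hz.pow 2).sub_const 1).sqrt hz2.ne'
  have hp0 : 0 < √(y e ^ 2 - 1) := sqrt_pos.2 hy2
  have hq0 : 0 < √(z e ^ 2 - 1) := sqrt_pos.2 hz2
  have hinv := (hasDerivAt_inv (mul_pos hp0 hq0).ne').comp_hasFDerivAt e (hp.mul hq)
  have hg := ((hy.mul hz).sub hx).mul hinv
  have hfun : (y * z - x) * ((fun t : ℝ => t⁻¹) ∘ ((fun t => √(y t ^ 2 - 1)) *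
      fun t => √(z t ^ 2 - 1))) =
      fun t => (y t * z t - x t) / (√(y t ^ 2 - 1) * √(z t ^ 2 - 1)) := by
    ext t
    simp [div_eq_mul_inv]
  rw [hfun] at hg
  have hsq : 1 - ((y e * z e - x e) / (√(y e ^ 2 - 1) * √(z e ^ 2 - 1))) ^ 2 =
      gramDet (x e) (y e) (z e) / (√(y e ^ 2 - 1) * √(z e ^ 2 - 1)) ^ 2 := by
    rw [div_pow, mul_pow, sq_sqrt hy2.le, sq_sqrt hz2.le, gramDet]
    field_simp
    ring
  have hlt : ((y e * z e - x e) / (√(y e ^ 2 - 1) * √(z e ^ 2 - 1))) ^ 2 < 1 := by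
    have : 0 < gramDet (x e) (y e) (z e) / (√(y e ^ 2 - 1) * √(z e ^ 2 - 1)) ^ 2 := by positivity
    linarith
  have hlt' := abs_lt.1 ((sq_lt_one_iff_abs_lt_one _).1 hlt)
  have harc := (hasDerivAt_arccos hlt'.1.ne' hlt'.2.ne).comp_hasFDerivAt e hg
  refine harc.congr_fderiv ?_
  rw [hsq, sqrt_div' _ (sq_nonneg _), sqrt_sq (mul_pos hp0 hq0).le]
  have hD0 : 0 < √(gramDet (x e) (y e) (z e)) := sqrt_pos.2 hD
  have h1 := sq_sqrt hy2.le
  have h2 := sq_sqrt hz2.le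
  ext v
  simp only [smul_apply, sub_apply, add_apply, smul_eq_mul, Pi.mul_apply, Pi.sub_apply,
    Function.comp_apply, nsmul_eq_mul, Nat.cast_ofNat]
  generalize √(gramDet (x e) (y e) (z e)) = D at *
  generalize √(y e ^ 2 - 1) = p at *
  generalize √(z e ^ 2 - 1) = q at *
  rw [← h1, ← h2]
  field_simp
  linear_combination (-q ^ 2 * y' v * z e) * h1 - (p ^ 2 * z' v * y e) * h2

theorem hasFDerivAt_cosh_sinh {r₁ r₂ : G → ℝ} {v₁ v₂ : G →L[ℝ] ℝ} {e : G} (C : ℝ)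
    (h₁ : HasFDerivAt r₁ (sinh (r₁ e) • v₁) e) (h₂ : HasFDerivAt r₂ (sinh (r₂ e) • v₂) e) :
    HasFDerivAt (fun t => cosh (r₁ t) * cosh (r₂ t) + sinh (r₁ t) * sinh (r₂ t) * C)
      ((cosh (r₁ e) * (cosh (r₁ e) * cosh (r₂ e) + sinh (r₁ e) * sinh (r₂ e) * C)
          - cosh (r₂ e)) • v₁ +
        (cosh (r₂ e) * (cosh (r₁ e) * cosh (r₂ e) + sinh (r₁ e) * sinh (r₂ e) * C)
          - cosh (r₁ e)) • v₂) e := by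
  refine ((h₁.cosh.mul h₂.cosh).add ((h₁.sinh.mul h₂.sinh).mul_const C)).congr_fderiv ?_
  ext v
  have e1 := cosh_sq (r₁ e)
  have e2 := cosh_sq (r₂ e)
  simp only [smul_apply, add_apply, smul_eq_mul]
  linear_combination (-cosh (r₂ e) * v₁ v) * e1 - (cosh (r₁ e) * v₂ v) * e2

end generic

/-- The derivative of the inner angle at one end of the side `a` with respect to the logarithmic
radius coordinate `log (tanh (r / 2))` at the other end of that side. -/
def sideCoeff (φ ρ : Fin 3 → ℝ) (a : Fin 3) : ℝ :=
  coeffNum (cosh (ρ a)) (cosh (ρ (a + 1))) (cosh (ρ (a + 2)))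
      (sideCosh φ ρ a) (sideCosh φ ρ (a + 1)) (sideCosh φ ρ (a + 2)) /
    ((sideCosh φ ρ a ^ 2 - 1) *
      √(gramDet (sideCosh φ ρ a) (sideCosh φ ρ (a + 1)) (sideCosh φ ρ (a + 2))))

theorem fin3_add_one_add_one (a : Fin 3) : a + 1 + 1 = a + 2 := by revert a; decide
theorem fin3_add_one_add_two (a : Fin 3) : a + 1 + 2 = a := by revert a; decide
theorem fin3_add_two_add_one (a : Fin 3) : a + 2 + 1 = a := by revert a; decide
theorem fin3_add_two_add_two (a : Fin 3) : a + 2 + 2 = a + 1 := by revert a; decide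

theorem sideCosh_add_one (φ ρ : Fin 3 → ℝ) (a : Fin 3) : sideCosh φ ρ (a + 1) =
    cosh (ρ (a + 2)) * cosh (ρ a) + sinh (ρ (a + 2)) * sinh (ρ a) * cos (φ (a + 1)) := by
  rw [sideCosh, fin3_add_one_add_one, fin3_add_one_add_two]

theorem sideCosh_add_two (φ ρ : Fin 3 → ℝ) (a : Fin 3) : sideCosh φ ρ (a + 2) =
    cosh (ρ a) * cosh (ρ (a + 1)) + sinh (ρ a) * sinh (ρ (a + 1)) * cos (φ (a + 2)) := by
  rw [sideCosh, fin3_add_two_add_one, fin3_add_two_add_two]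

section positivity

variable {φ ρ : Fin 3 → ℝ}

theorem sideCosh_ge (hρ : ∀ a, 0 < ρ a) (hφ : ∀ a, 0 ≤ cos (φ a)) (a : Fin 3) :
    cosh (ρ (a + 1)) * cosh (ρ (a + 2)) ≤ sideCosh φ ρ a := by
  have h1 := sinh_pos_iff.2 (hρ (a + 1))
  have h2 := sinh_pos_iff.2 (hρ (a + 2))
  have := hφ a
  have : 0 ≤ sinh (ρ (a + 1)) * sinh (ρ (a + 2)) * cos (φ a) := by positivity
  rw [sideCosh]; linarith

theorem sideCosh_sq_ge (hρ : ∀ a, 0 < ρ a) (hφ : ∀ a, 0 ≤ cos (φ a)) (a : Fin 3) :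
    sinh (ρ (a + 1)) ^ 2 + sinh (ρ (a + 2)) ^ 2 ≤ sideCosh φ ρ a ^ 2 - 1 := by
  have h := sideCosh_ge hρ hφ a
  have h1 := cosh_sq (ρ (a + 1))
  have h2 := cosh_sq (ρ (a + 2))
  have h3 := cosh_pos (ρ (a + 1))
  have h4 := cosh_pos (ρ (a + 2))
  have h5 : (cosh (ρ (a + 1)) * cosh (ρ (a + 2))) ^ 2 ≤ sideCosh φ ρ a ^ 2 :=
    pow_le_pow_left₀ (by positivity) h 2
  rw [mul_pow, h1, h2] at h5
  nlinarith [sq_nonneg (sinh (ρ (a + 1)) * sinh (ρ (a + 2)))]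

theorem one_lt_sideCosh (hρ : ∀ a, 0 < ρ a) (hφ : ∀ a, 0 ≤ cos (φ a)) (a : Fin 3) :
    1 < sideCosh φ ρ a := by
  refine lt_of_lt_of_le ?_ (sideCosh_ge hρ hφ a)
  have h1 := one_lt_cosh.2 (hρ (a + 1)).ne'
  have h2 := one_lt_cosh.2 (hρ (a + 2)).ne'
  nlinarith

theorem sideCosh_le (hρ : ∀ a, 0 < ρ a) (a : Fin 3) :
    sideCosh φ ρ a ≤ 2 * (cosh (ρ (a + 1)) * cosh (ρ (a + 2))) := by
  have h1 := sinh_pos_iff.2 (hρ (a + 1))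
  have h2 := sinh_pos_iff.2 (hρ (a + 2))
  have h3 : sinh (ρ (a + 1)) * sinh (ρ (a + 2)) * cos (φ a) ≤
      sinh (ρ (a + 1)) * sinh (ρ (a + 2)) * 1 :=
    mul_le_mul_of_nonneg_left (cos_le_one _) (by positivity)
  have h4 : sinh (ρ (a + 1)) * sinh (ρ (a + 2)) ≤ cosh (ρ (a + 1)) * cosh (ρ (a + 2)) :=
    mul_le_mul (sinh_lt_cosh _).le (sinh_lt_cosh _).le h2.le (cosh_pos _).le
  rw [sideCosh]; linarith

/-- Lower bounds for the Gram determinant, of the second order in two of the radii. In particular it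
is positive, so that the triangle inequalities hold for any three circles. -/
theorem gramDet_ge (hρ : ∀ a, 0 < ρ a) (hφ : ∀ a, 0 ≤ cos (φ a)) (a : Fin 3) {m : ℝ}
    (hm : 0 ≤ m) (hm₁ : m ≤ sinh (ρ (a + 1))) (hm₂ : m ≤ sinh (ρ (a + 2))) :
    (sinh (ρ a) * m) ^ 2 ≤
        gramDet (sideCosh φ ρ a) (sideCosh φ ρ (a + 1)) (sideCosh φ ρ (a + 2)) ∧
      (sinh (ρ (a + 1)) * sinh (ρ (a + 2)) * (1 - cos (φ a) ^ 2)) ^ 2 ≤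
        gramDet (sideCosh φ ρ a) (sideCosh φ ρ (a + 1)) (sideCosh φ ρ (a + 2)) := by
  rw [sideCosh_add_one, sideCosh_add_two, sideCosh, gramDet_expand (cosh_sq _) (cosh_sq _)
    (cosh_sq _)]
  have s1 := sinh_pos_iff.2 (hρ a)
  have s2 := sinh_pos_iff.2 (hρ (a + 1))
  have s3 := sinh_pos_iff.2 (hρ (a + 2))
  have c1 := one_le_cosh (ρ a)
  have c2 := one_le_cosh (ρ (a + 1))
  have c3 := one_le_cosh (ρ (a + 2))
  have a1 := hφ a
  have a2 := hφ (a + 1)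
  have a3 := hφ (a + 2)
  have b1 : 0 ≤ 1 - cos (φ a) ^ 2 := by nlinarith [cos_le_one (φ a)]
  have b2 : 0 ≤ 1 - cos (φ (a + 1)) ^ 2 := by nlinarith [cos_le_one (φ (a + 1))]
  have b3 : 0 ≤ 1 - cos (φ (a + 2)) ^ 2 := by nlinarith [cos_le_one (φ (a + 2))]
  have b1' : 1 - cos (φ a) ^ 2 ≤ 1 := by nlinarith
  have d2 := cos_le_one (φ (a + 1))
  have d3 := cos_le_one (φ (a + 2))
  generalize sinh (ρ a) = s₁ at *
  generalize sinh (ρ (a + 1)) = s₂ at *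
  generalize sinh (ρ (a + 2)) = s₃ at *
  generalize cosh (ρ a) = c₁ at *
  generalize cosh (ρ (a + 1)) = c₂ at *
  generalize cosh (ρ (a + 2)) = c₃ at *
  generalize cos (φ a) = α at *
  generalize cos (φ (a + 1)) = β at *
  generalize cos (φ (a + 2)) = δ at *
  have t1 : 0 ≤ s₁ ^ 2 * s₂ ^ 2 * (1 - δ ^ 2) := by positivity
  have t2 : 0 ≤ s₂ ^ 2 * s₃ ^ 2 * (1 - α ^ 2) := by positivity
  have t3 : 0 ≤ s₁ ^ 2 * s₃ ^ 2 * (1 - β ^ 2) := by positivity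
  have t4 : 0 ≤ 2 * s₁ ^ 2 * s₂ ^ 2 * s₃ ^ 2 * (1 + α * β * δ) := by positivity
  have t5 : 0 ≤ c₂ * c₃ * s₁ ^ 2 * s₂ * s₃ * (α + β * δ) := by positivity
  have t6 : 0 ≤ c₁ * c₃ * s₁ * s₃ * s₂ ^ 2 * (β + α * δ) := by positivity
  have t7 : 0 ≤ c₁ * c₂ * s₁ * s₂ * s₃ ^ 2 * (δ + α * β) := by positivity
  constructor
  · have u1 : s₁ ^ 2 * m ^ 2 * (1 - δ ^ 2) ≤ s₁ ^ 2 * s₂ ^ 2 * (1 - δ ^ 2) := by gcongr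
    have u3 : s₁ ^ 2 * m ^ 2 * (1 - β ^ 2) ≤ s₁ ^ 2 * s₃ ^ 2 * (1 - β ^ 2) := by gcongr
    have u5 : 1 * 1 * s₁ ^ 2 * m * m * (0 + β * δ) ≤ c₂ * c₃ * s₁ ^ 2 * s₂ * s₃ * (α + β * δ) := by
      gcongr
    have u : 0 ≤ (s₁ * m) ^ 2 * (1 - (β - δ) ^ 2) := by
      have : 0 ≤ 1 - (β - δ) ^ 2 := by nlinarith
      positivity
    nlinarith
  · have : (s₂ * s₃ * (1 - α ^ 2)) ^ 2 ≤ s₂ ^ 2 * s₃ ^ 2 * (1 - α ^ 2) := by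
      rw [mul_pow, mul_pow]
      have : (1 - α ^ 2) ^ 2 ≤ 1 - α ^ 2 := by nlinarith
      gcongr
    linarith

theorem gramDet_pos (hρ : ∀ a, 0 < ρ a) (hφ : ∀ a, 0 ≤ cos (φ a)) (a : Fin 3) :
    0 < gramDet (sideCosh φ ρ a) (sideCosh φ ρ (a + 1)) (sideCosh φ ρ (a + 2)) := by
  have s1 := sinh_pos_iff.2 (hρ a)
  have s2 := sinh_pos_iff.2 (hρ (a + 1))
  have s3 := sinh_pos_iff.2 (hρ (a + 2))
  have h := (gramDet_ge hρ hφ a (le_min s2.le s3.le) (min_le_left _ _) (min_le_right _ _)).1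
  have : 0 < min (sinh (ρ (a + 1))) (sinh (ρ (a + 2))) := lt_min s2 s3
  exact lt_of_lt_of_le (by positivity) h

theorem sideCoeff_eq (a : Fin 3) : sideCoeff φ ρ a =
    sinh (ρ (a + 1)) * sinh (ρ (a + 2)) *
      (cosh (ρ a) * sinh (ρ (a + 1)) * sinh (ρ (a + 2)) * (1 - cos (φ a) ^ 2)
        + cosh (ρ (a + 1)) * sinh (ρ (a + 2)) * sinh (ρ a) *
          (cos (φ (a + 2)) + cos (φ a) * cos (φ (a + 1)))
        + cosh (ρ (a + 2)) * sinh (ρ (a + 1)) * sinh (ρ a) *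
          (cos (φ (a + 1)) + cos (φ a) * cos (φ (a + 2)))) /
      ((sideCosh φ ρ a ^ 2 - 1) *
        √(gramDet (sideCosh φ ρ a) (sideCosh φ ρ (a + 1)) (sideCosh φ ρ (a + 2)))) := by
  rw [sideCoeff]
  congr 1
  rw [sideCosh_add_one, sideCosh_add_two, sideCosh, coeffNum_expand (cosh_sq _) (cosh_sq _)]

theorem sideCoeff_nonneg (hρ : ∀ a, 0 < ρ a) (hφ : ∀ a, 0 ≤ cos (φ a)) (a : Fin 3) :
    0 ≤ sideCoeff φ ρ a := by
  rw [sideCoeff_eq]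
  have s1 := sinh_pos_iff.2 (hρ a)
  have s2 := sinh_pos_iff.2 (hρ (a + 1))
  have s3 := sinh_pos_iff.2 (hρ (a + 2))
  have a1 := hφ a
  have a2 := hφ (a + 1)
  have a3 := hφ (a + 2)
  have b1 : 0 ≤ 1 - cos (φ a) ^ 2 := by nlinarith [cos_le_one (φ a)]
  have x1 : 0 ≤ sideCosh φ ρ a ^ 2 - 1 := by nlinarith [one_lt_sideCosh hρ hφ a]
  positivity

/-- The coefficients of the two sides at a corner do not both vanish. -/
theorem sideCoeff_pos_or (hρ : ∀ a, 0 < ρ a) (hφ : ∀ a, 0 ≤ cos (φ a)) (a : Fin 3) :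
    0 < sideCoeff φ ρ (a + 1) ∨ 0 < sideCoeff φ ρ (a + 2) := by
  have s1 := sinh_pos_iff.2 (hρ a)
  have s2 := sinh_pos_iff.2 (hρ (a + 1))
  have s3 := sinh_pos_iff.2 (hρ (a + 2))
  have a1 := hφ a
  have a2 := hφ (a + 1)
  have a3 := hφ (a + 2)
  have D1 := gramDet_pos hρ hφ (a + 1)
  have D2 := gramDet_pos hρ hφ (a + 2)
  have x1 : 0 < sideCosh φ ρ (a + 1) ^ 2 - 1 := by nlinarith [one_lt_sideCosh hρ hφ (a + 1)]
  have x2 : 0 < sideCosh φ ρ (a + 2) ^ 2 - 1 := by nlinarith [one_lt_sideCosh hρ hφ (a + 2)]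
  rcases (cos_le_one (φ (a + 1))).lt_or_eq with h | h
  · left
    have b : 0 < 1 - cos (φ (a + 1)) ^ 2 := by nlinarith
    rw [sideCoeff_eq]
    simp only [fin3_add_one_add_one, fin3_add_one_add_two] at *
    positivity
  · right
    have b : 0 ≤ 1 - cos (φ (a + 2)) ^ 2 := by nlinarith [cos_le_one (φ (a + 2))]
    rw [sideCoeff_eq]
    simp only [fin3_add_two_add_one, fin3_add_two_add_two] at *
    rw [h]
    positivity

/-- The coefficients stay bounded when radii tend to `0`: numerator and denominator are then of the
same order. -/
theorem sideCoeff_le (hρ : ∀ a, 0 < ρ a) (hφ : ∀ a, 0 ≤ cos (φ a)) (a : Fin 3) {C : ℝ}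
    (hC : ∀ b, cosh (ρ b) ≤ C) : sideCoeff φ ρ a ≤ 5 * C := by
  have s1 := sinh_pos_iff.2 (hρ a)
  have s2 := sinh_pos_iff.2 (hρ (a + 1))
  have s3 := sinh_pos_iff.2 (hρ (a + 2))
  have x1 := sideCosh_sq_ge hρ hφ a
  have D0 := sqrt_pos.2 (gramDet_pos hρ hφ a)
  have hC0 : 0 < C := (cosh_pos _).trans_le (hC 0)
  have D1 : sinh (ρ (a + 1)) * sinh (ρ (a + 2)) * (1 - cos (φ a) ^ 2) ≤
      √(gramDet (sideCosh φ ρ a) (sideCosh φ ρ (a + 1)) (sideCosh φ ρ (a + 2))) :=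
    le_sqrt_of_sq_le (gramDet_ge hρ hφ a le_rfl s2.le s3.le).2
  have D2 : sinh (ρ a) * min (sinh (ρ (a + 1))) (sinh (ρ (a + 2))) ≤
      √(gramDet (sideCosh φ ρ a) (sideCosh φ ρ (a + 1)) (sideCosh φ ρ (a + 2))) :=
    le_sqrt_of_sq_le
      (gramDet_ge hρ hφ a (le_min s2.le s3.le) (min_le_left _ _) (min_le_right _ _)).1
  rw [sideCoeff_eq, div_le_iff₀ (by nlinarith [mul_pos s2 s2])]
  have c1 := hC a
  have c2 := hC (a + 1)
  have c3 := hC (a + 2)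
  have p1 := cosh_pos (ρ a)
  have p2 := cosh_pos (ρ (a + 1))
  have p3 := cosh_pos (ρ (a + 2))
  have a1 := hφ a
  have a2 := hφ (a + 1)
  have a3 := hφ (a + 2)
  have b1 : 0 ≤ 1 - cos (φ a) ^ 2 := by nlinarith [cos_le_one (φ a)]
  have e1 : cos (φ (a + 2)) + cos (φ a) * cos (φ (a + 1)) ≤ 2 := by
    nlinarith [cos_le_one (φ a), cos_le_one (φ (a + 1)), cos_le_one (φ (a + 2))]
  have e2 : cos (φ (a + 1)) + cos (φ a) * cos (φ (a + 2)) ≤ 2 := by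
    nlinarith [cos_le_one (φ a), cos_le_one (φ (a + 1)), cos_le_one (φ (a + 2))]
  generalize √(gramDet (sideCosh φ ρ a) (sideCosh φ ρ (a + 1)) (sideCosh φ ρ (a + 2))) = D at *
  have f1 : 0 ≤ cos (φ (a + 2)) + cos (φ a) * cos (φ (a + 1)) := by positivity
  have f2 : 0 ≤ cos (φ (a + 1)) + cos (φ a) * cos (φ (a + 2)) := by positivity
  generalize cos (φ (a + 2)) + cos (φ a) * cos (φ (a + 1)) = g₁ at *
  generalize cos (φ (a + 1)) + cos (φ a) * cos (φ (a + 2)) = g₂ at *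
  generalize 1 - cos (φ a) ^ 2 = α at *
  generalize sideCosh φ ρ a ^ 2 - 1 = X at *
  generalize sinh (ρ a) = s₁ at *
  generalize sinh (ρ (a + 1)) = s₂ at *
  generalize sinh (ρ (a + 2)) = s₃ at *
  generalize cosh (ρ a) = c₁ at *
  generalize cosh (ρ (a + 1)) = c₂ at *
  generalize cosh (ρ (a + 2)) = c₃ at *
  -- the two bounds of the Gram determinant serve different terms of the numerator
  have k1 : s₂ * s₃ * (c₁ * s₂ * s₃ * α) ≤ C * X * D := by
    calc s₂ * s₃ * (c₁ * s₂ * s₃ * α) = c₁ * (s₂ * s₃) * (s₂ * s₃ * α) := by ring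
      _ ≤ C * X * D := by
        gcongr
        · nlinarith
        · nlinarith [sq_nonneg (s₂ - s₃)]
  have k2 : s₂ * s₃ * (c₂ * s₃ * s₁ * g₁ + c₃ * s₂ * s₁ * g₂) ≤ 4 * C * X * D := by
    calc s₂ * s₃ * (c₂ * s₃ * s₁ * g₁ + c₃ * s₂ * s₁ * g₂)
        ≤ s₂ * s₃ * (C * s₃ * s₁ * 2 + C * s₂ * s₁ * 2) := by gcongr
      _ = 2 * C * (s₁ * min s₂ s₃) * (max s₂ s₃ * (s₂ + s₃)) := by
        linear_combination (2 * C * s₁ * (s₂ + s₃)) * (min_mul_max s₂ s₃).symm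
      _ ≤ 2 * C * D * (2 * X) := by
        have hmax : max s₂ s₃ * (s₂ + s₃) ≤ 2 * X := by
          rcases le_total s₂ s₃ with h | h
          · rw [max_eq_right h]; nlinarith
          · rw [max_eq_left h]; nlinarith
        exact mul_le_mul (mul_le_mul_of_nonneg_left D2 (by positivity)) hmax
          (by positivity) (by positivity)
      _ = 4 * C * X * D := by ring
  linarith

/-- The inner angle at a corner tends to `0` as the radius at that corner tends to infinity,
uniformly in the other two radii. -/
theorem cornerAngle_le (hρ : ∀ a, 0 < ρ a) (hφ : ∀ a, 0 ≤ cos (φ a)) (a : Fin 3) {δ : ℝ}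
    (hδ₀ : 0 ≤ δ) (hδ : δ ≤ π) (h : cos δ ≤ 1 - 2 / sinh (ρ a) ^ 2) :
    cornerAngle φ ρ a ≤ δ := by
  have x1 := one_lt_sideCosh hρ hφ a
  have x2 := one_lt_sideCosh hρ hφ (a + 1)
  have x3 := one_lt_sideCosh hρ hφ (a + 2)
  have s1 := sinh_pos_iff.2 (hρ a)
  have p2 := cosh_pos (ρ (a + 1))
  have p3 := cosh_pos (ρ (a + 2))
  have key : cornerAngle φ ρ a = arccos
      ((sideCosh φ ρ (a + 1) * sideCosh φ ρ (a + 2) - sideCosh φ ρ a) /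
        (√(sideCosh φ ρ (a + 1) ^ 2 - 1) * √(sideCosh φ ρ (a + 2) ^ 2 - 1))) := by
    change hypAngle (arcosh (sideCosh φ ρ a)) (arcosh (sideCosh φ ρ (a + 1)))
      (arcosh (sideCosh φ ρ (a + 2))) = _
    rw [hypAngle, cosh_arcosh x1.le, cosh_arcosh x2.le, cosh_arcosh x3.le, sinh_arcosh x2.le,
      sinh_arcosh x3.le]
  have q2 : cosh (ρ (a + 2)) * sinh (ρ a) ≤ √(sideCosh φ ρ (a + 1) ^ 2 - 1) := by
    have := sideCosh_ge hρ hφ (a + 1)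
    rw [fin3_add_one_add_one, fin3_add_one_add_two] at this
    refine le_sqrt_of_sq_le ?_
    have h2 := pow_le_pow_left₀ (mul_pos (cosh_pos _) (cosh_pos _)).le this 2
    have h3 := one_le_cosh (ρ (a + 2))
    rw [mul_pow, cosh_sq (ρ a)] at h2
    nlinarith
  have q3 : cosh (ρ (a + 1)) * sinh (ρ a) ≤ √(sideCosh φ ρ (a + 2) ^ 2 - 1) := by
    have := sideCosh_ge hρ hφ (a + 2)
    rw [fin3_add_two_add_one, fin3_add_two_add_two] at this
    refine le_sqrt_of_sq_le ?_
    have h2 := pow_le_pow_left₀ (mul_pos (cosh_pos _) (cosh_pos _)).le this 2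
    have h3 := one_le_cosh (ρ (a + 1))
    rw [mul_pow, cosh_sq (ρ a)] at h2
    nlinarith
  have q2' : √(sideCosh φ ρ (a + 1) ^ 2 - 1) ≤ sideCosh φ ρ (a + 1) :=
    sqrt_le_iff.2 ⟨by linarith, by linarith⟩
  have q3' : √(sideCosh φ ρ (a + 2) ^ 2 - 1) ≤ sideCosh φ ρ (a + 2) :=
    sqrt_le_iff.2 ⟨by linarith, by linarith⟩
  have hx := sideCosh_le (φ := φ) hρ a
  rw [key, ← arccos_cos hδ₀ hδ]
  refine arccos_le_arccos (h.trans ?_)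
  generalize √(sideCosh φ ρ (a + 1) ^ 2 - 1) = P at *
  generalize √(sideCosh φ ρ (a + 2) ^ 2 - 1) = Q at *
  have hP : 0 < P := lt_of_lt_of_le (by positivity) q2
  have hQ : 0 < Q := lt_of_lt_of_le (by positivity) q3
  rw [le_div_iff₀ (by positivity)]
  have r1 : 2 / sinh (ρ a) ^ 2 * ((cosh (ρ (a + 2)) * sinh (ρ a)) * (cosh (ρ (a + 1)) * sinh (ρ a)))
      ≤ 2 / sinh (ρ a) ^ 2 * (P * Q) := by gcongr
  have r2 : 2 / sinh (ρ a) ^ 2 * ((cosh (ρ (a + 2)) * sinh (ρ a)) * (cosh (ρ (a + 1)) * sinh (ρ a)))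
      = 2 * (cosh (ρ (a + 1)) * cosh (ρ (a + 2))) := by field_simp
  have r3 : P * Q ≤ sideCosh φ ρ (a + 1) * sideCosh φ ρ (a + 2) := by gcongr
  nlinarith

end positivity

section derivative

variable {G : Type*} [NormedAddCommGroup G] [NormedSpace ℝ G]

/-- The differential of the inner angle at the corner `a`, when the radii `r b` at the three
corners vary in such a way that the logarithmic radius coordinates have differentials `v b`. -/
theorem hasFDerivAt_cornerAngle {φ : Fin 3 → ℝ} (hφ : ∀ a, 0 ≤ cos (φ a)) {r : Fin 3 → G → ℝ}
    {v : Fin 3 → G →L[ℝ] ℝ} {e : G} (hr₀ : ∀ b, 0 < r b e)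
    (hr : ∀ b, HasFDerivAt (r b) (sinh (r b e) • v b) e) (a : Fin 3) :
    HasFDerivAt (fun t => cornerAngle φ (fun b => r b t) a)
      (sideCoeff φ (fun b => r b e) (a + 1) •
          (v (a + 2) - sideCosh φ (fun b => r b e) (a + 1) • v a) +
        sideCoeff φ (fun b => r b e) (a + 2) •
          (v (a + 1) - sideCosh φ (fun b => r b e) (a + 2) • v a)) e := by
  have x1 := one_lt_sideCosh hr₀ hφ a
  have x2 := one_lt_sideCosh hr₀ hφ (a + 1)
  have x3 := one_lt_sideCosh hr₀ hφ (a + 2)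
  have D := gramDet_pos hr₀ hφ a
  have h1 : HasFDerivAt (fun t => sideCosh φ (fun b => r b t) a)
      ((cosh (r (a + 1) e) * sideCosh φ (fun b => r b e) a - cosh (r (a + 2) e)) • v (a + 1) +
        (cosh (r (a + 2) e) * sideCosh φ (fun b => r b e) a - cosh (r (a + 1) e)) • v (a + 2)) e :=
    hasFDerivAt_cosh_sinh (cos (φ a)) (hr (a + 1)) (hr (a + 2))
  have h2 : HasFDerivAt (fun t => sideCosh φ (fun b => r b t) (a + 1))
      ((cosh (r (a + 2) e) * sideCosh φ (fun b => r b e) (a + 1) - cosh (r a e)) • v (a + 2) +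
        (cosh (r a e) * sideCosh φ (fun b => r b e) (a + 1) - cosh (r (a + 2) e)) • v a) e := by
    simp only [sideCosh_add_one]
    exact hasFDerivAt_cosh_sinh (cos (φ (a + 1))) (hr (a + 2)) (hr a)
  have h3 : HasFDerivAt (fun t => sideCosh φ (fun b => r b t) (a + 2))
      ((cosh (r a e) * sideCosh φ (fun b => r b e) (a + 2) - cosh (r (a + 1) e)) • v a +
        (cosh (r (a + 1) e) * sideCosh φ (fun b => r b e) (a + 2) - cosh (r a e)) • v (a + 1))
      e := by
    simp only [sideCosh_add_two]
    exact hasFDerivAt_cosh_sinh (cos (φ (a + 2))) (hr a) (hr (a + 1))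
  refine (hasFDerivAt_hypAngle_arcosh h1 h2 h3 x1 x2 x3 D).congr_fderiv ?_
  have x2' : sideCosh φ (fun b => r b e) (a + 1) ^ 2 - 1 ≠ 0 := by nlinarith
  have x3' : sideCosh φ (fun b => r b e) (a + 2) ^ 2 - 1 ≠ 0 := by nlinarith
  have D0 := (sqrt_pos.2 D).ne'
  simp only [sideCoeff, fin3_add_one_add_one, fin3_add_one_add_two, fin3_add_two_add_one,
    fin3_add_two_add_two]
  rw [gramDet_rotate (sideCosh φ (fun b => r b e) (a + 1)) _ _,
    gramDet_rotate (sideCosh φ (fun b => r b e) a) _ _]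
  generalize √(gramDet (sideCosh φ (fun b => r b e) a) _ _) = D at *
  generalize sideCosh φ (fun b => r b e) a = X₁ at *
  generalize sideCosh φ (fun b => r b e) (a + 1) = X₂ at *
  generalize sideCosh φ (fun b => r b e) (a + 2) = X₃ at *
  ext w
  simp only [smul_apply, sub_apply, add_apply, smul_eq_mul, coeffNum]
  field_simp
  ring

end derivative

end CirclePacking

/-! ### Existence of solutions for continuous vector fields -/

namespace CirclePacking

section Peano

variable {G : Type*} [NormedAddCommGroup G] [NormedSpace ℝ G] [FiniteDimensional ℝ G]

/-- Picard-Lindelöf for a bounded vector field, on an arbitrary time interval. -/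
theorem exists_solution_of_contDiff {X : G → G} (hX : ContDiff ℝ 1 X) {C : ℝ}
    (hC : ∀ x, ‖X x‖ ≤ C) (x₀ : G) {T : ℝ} (hT : 0 ≤ T) :
    ∃ u : ℝ → G, u 0 = x₀ ∧
      ∀ t ∈ Set.Icc 0 T, HasDerivWithinAt u (X (u t)) (Set.Icc 0 T) t := by
  have hC0 : 0 ≤ C := (norm_nonneg _).trans (hC 0)
  obtain ⟨K, hK⟩ := (hX.locallyLipschitz.locallyLipschitzOn
    (s := Metric.closedBall x₀ (C * T))).exists_lipschitzOnWith_of_compact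
    (isCompact_closedBall x₀ (C * T))
  have hpl : IsPicardLindelof (fun _ : ℝ => X) (tmin := 0) (tmax := T) ⟨0, le_rfl, hT⟩ x₀
      ⟨C * T, by positivity⟩ 0 ⟨C, hC0⟩ K := by
    refine IsPicardLindelof.of_time_independent (fun x _ => hC x) hK ?_
    simp only [sub_zero, sub_self, max_eq_left hT, NNReal.coe_zero]
    exact le_rfl
  exact hpl.exists_eq_forall_mem_Icc_hasDerivWithinAt₀

/-- Peano's existence theorem for a bounded continuous vector field. The solution is a limit, along
an ultrafilter, of solutions for smooth vector fields approximating the given one. -/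
theorem exists_solution_of_continuous {X : G → G} (hX : Continuous X) {C : ℝ}
    (hC : ∀ x, ‖X x‖ ≤ C) (x₀ : G) {T : ℝ} (hT : 0 ≤ T) :
    ∃ u : ℝ → G, u 0 = x₀ ∧
      ∀ t ∈ Set.Icc 0 T, HasDerivWithinAt u (X (u t)) (Set.Icc 0 T) t := by
  have hC0 : 0 ≤ C := (norm_nonneg _).trans (hC 0)
  have hap : ∀ n : ℕ, ∃ g : G → G, ContDiff ℝ 1 g ∧ ∀ x, dist (g x) (X x) < 1 / ((n : ℝ) + 1) := by
    intro n
    obtain ⟨g, hg, hg', -⟩ := hX.exists_contDiff_approx 1 (ε := fun _ => 1 / ((n : ℝ) + 1))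
      continuous_const (fun _ => by positivity)
    exact ⟨g, hg, hg'⟩
  choose g hg hgX using hap
  have hgC : ∀ n x, ‖g n x‖ ≤ C + 1 := by
    intro n x
    have h1 := hgX n x
    rw [dist_eq_norm] at h1
    have h2 : 1 / ((n : ℝ) + 1) ≤ 1 := by
      rw [div_le_one (by positivity)]; linarith [n.cast_nonneg (α := ℝ)]
    have h3 := norm_le_norm_sub_add (g n x) (X x)
    linarith [hC x]
  choose w hw0 hw using fun n => exists_solution_of_contDiff (hg n) (hgC n) x₀ hT
  have hLip : ∀ n, ∀ s ∈ Set.Icc 0 T, ∀ t ∈ Set.Icc 0 T, ‖w n t - w n s‖ ≤ (C + 1) * ‖t - s‖ :=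
    fun n s hs t ht => (convex_Icc 0 T).norm_image_sub_le_of_norm_hasDerivWithin_le (hw n)
      (fun x _ => hgC n _) hs ht
  -- an ultrafilter makes all values converge at once, without extracting subsequences
  have hlim : ∀ t, ∃ y, t ∈ Set.Icc 0 T →
      Filter.Tendsto (fun n => w n t) (Filter.hyperfilter ℕ) (nhds y) := by
    intro t
    by_cases ht : t ∈ Set.Icc 0 T
    · obtain ⟨y, -, hy⟩ := (isCompact_closedBall x₀ ((C + 1) * T)).ultrafilter_le_nhds
        ((Filter.hyperfilter ℕ).map (fun n => w n t)) (by
          rw [Ultrafilter.coe_map, Filter.le_principal_iff, Filter.mem_map]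
          refine Filter.univ_mem' fun n => ?_
          rw [Set.mem_preimage, mem_closedBall_iff_norm, ← hw0 n]
          refine (hLip n 0 ⟨le_rfl, hT⟩ t ht).trans ?_
          have : ‖t - 0‖ ≤ T := by rw [sub_zero, Real.norm_of_nonneg ht.1]; exact ht.2
          gcongr)
      exact ⟨y, fun _ => hy⟩
    · exact ⟨0, fun h => absurd h ht⟩
  choose u hu using hlim
  have h0 : (0 : ℝ) ∈ Set.Icc 0 T := ⟨le_rfl, hT⟩
  refine ⟨u, ?_, fun s hs => ?_⟩
  · refine tendsto_nhds_unique (hu 0 h0) ?_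
    simp only [hw0]
    exact tendsto_const_nhds
  · rw [hasDerivWithinAt_iff_isLittleO, Asymptotics.isLittleO_iff]
    intro ε hε
    obtain ⟨δ, hδ, hδX⟩ := Metric.continuousAt_iff.1 (hX.continuousAt (x := u s)) (ε / 2)
      (half_pos hε)
    set η := δ / 2 / (C + 1) with hη
    have hη0 : 0 < η := by positivity
    have hball : Metric.ball s η ∈ nhdsWithin s (Set.Icc 0 T) :=
      mem_nhdsWithin_of_mem_nhds (Metric.ball_mem_nhds s hη0)
    filter_upwards [hball, self_mem_nhdsWithin] with t ht htT
    -- near `s` all approximate solutions have velocity almost `X (u s)`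
    have hev : ∀ᶠ n in (Filter.hyperfilter ℕ : Filter ℕ),
        ‖w n t - w n s - (t - s) • X (u s)‖ ≤ ε * ‖t - s‖ := by
      have e1 := (hu s hs).eventually (Metric.ball_mem_nhds (u s) (half_pos hδ))
      have e2 : ∀ᶠ n : ℕ in (Filter.hyperfilter ℕ : Filter ℕ), 1 / ((n : ℝ) + 1) < ε / 2 := by
        refine Filter.Eventually.filter_mono ?_
          ((tendsto_one_div_add_atTop_nhds_zero_nat (𝕜 := ℝ)).eventually
            (gt_mem_nhds (half_pos hε)))
        exact Nat.hyperfilter_le_atTop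
      filter_upwards [e1, e2] with n h1 h2
      have hconv : Convex ℝ (Set.Icc 0 T ∩ Metric.ball s η) :=
        (convex_Icc 0 T).inter (convex_ball s η)
      have hd : ∀ x ∈ Set.Icc 0 T ∩ Metric.ball s η,
          HasDerivWithinAt (fun x => w n x - x • X (u s)) (g n (w n x) - (1 : ℝ) • X (u s))
            (Set.Icc 0 T ∩ Metric.ball s η) x := fun x hx =>
        ((hw n x hx.1).mono Set.inter_subset_left).sub
          ((hasDerivWithinAt_id x _).smul_const (X (u s)))
      have hb : ∀ x ∈ Set.Icc 0 T ∩ Metric.ball s η,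
          ‖g n (w n x) - (1 : ℝ) • X (u s)‖ ≤ ε := by
        intro x hx
        have k1 := hgX n (w n x)
        have k2 : dist (w n x) (u s) < δ := by
          have := hLip n s hs x hx.1
          have hx2 : ‖x - s‖ < η := by simpa [dist_eq_norm] using hx.2
          have : ‖w n x - w n s‖ ≤ δ / 2 := by
            refine this.trans ?_
            calc (C + 1) * ‖x - s‖ ≤ (C + 1) * η := by gcongr
              _ = δ / 2 := by rw [hη]; field_simp
          have h1' : dist (w n s) (u s) < δ / 2 := h1
          calc dist (w n x) (u s) ≤ dist (w n x) (w n s) + dist (w n s) (u s) :=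
                dist_triangle _ _ _
            _ < δ := by rw [dist_eq_norm (w n x)]; linarith
        have k3 := hδX k2
        rw [one_smul, ← dist_eq_norm]
        linarith [dist_triangle (g n (w n x)) (X (w n x)) (X (u s))]
      have := hconv.norm_image_sub_le_of_norm_hasDerivWithin_le hd hb
        ⟨hs, Metric.mem_ball_self hη0⟩ ⟨htT, ht⟩
      convert this using 2
      rw [sub_smul]; abel
    refine le_of_tendsto ?_ hev
    exact (((hu t htT).sub (hu s hs)).sub_const _).norm

end Peano

end CirclePacking

/-! ### Differential inequalities and graph operators -/

namespace CirclePacking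

section scalar

/-- A form of Gronwall's inequality that needs no sign of the constant `C`. -/
theorem le_mul_exp_of_deriv_le {f f' : ℝ → ℝ} {C T : ℝ}
    (hf : ∀ t ∈ Set.Icc 0 T, HasDerivWithinAt f (f' t) (Set.Icc 0 T) t)
    (hle : ∀ t ∈ Set.Icc 0 T, f' t ≤ C * f t) {t : ℝ} (ht : t ∈ Set.Icc 0 T) :
    f t ≤ f 0 * Real.exp (C * t) := by
  have hd : ∀ t ∈ Set.Icc 0 T, HasDerivWithinAt (fun t => f t * Real.exp (-C * t))
      ((f' t - C * f t) * Real.exp (-C * t)) (Set.Icc 0 T) t := by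
    intro t ht
    have h2 : HasDerivWithinAt (fun t => Real.exp (-C * t)) (Real.exp (-C * t) * (-C * 1))
        (Set.Icc 0 T) t := ((hasDerivAt_id t).const_mul (-C)).exp.hasDerivWithinAt
    refine ((hf t ht).mul h2).congr_deriv ?_
    ring
  have hanti : AntitoneOn (fun t => f t * Real.exp (-C * t)) (Set.Icc 0 T) := by
    refine antitoneOn_of_hasDerivWithinAt_nonpos (convex_Icc 0 T)
      (fun t ht => (hd t ht).continuousWithinAt)
      (fun t ht => (hd t (interior_subset ht)).mono interior_subset) fun t ht => ?_
    have := hle t (interior_subset ht)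
    exact mul_nonpos_of_nonpos_of_nonneg (by linarith) (Real.exp_pos _).le
  have h := hanti ⟨le_rfl, ht.1.trans ht.2⟩ ht ht.1
  simp only [mul_zero, Real.exp_zero, mul_one] at h
  calc f t = f t * Real.exp (-C * t) * Real.exp (C * t) := by
        rw [mul_assoc, ← Real.exp_add]; simp
    _ ≤ f 0 * Real.exp (C * t) := by gcongr

/-- A function that does not increase while it is above the level `b` does not cross this level. -/
theorem le_of_deriv_nonpos_above {f f' : ℝ → ℝ} {b T : ℝ}
    (hf : ∀ t ∈ Set.Icc 0 T, HasDerivWithinAt f (f' t) (Set.Icc 0 T) t) (h0 : f 0 ≤ b)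
    (hle : ∀ t ∈ Set.Icc 0 T, b ≤ f t → f' t ≤ 0) {t : ℝ} (ht : t ∈ Set.Icc 0 T) : f t ≤ b := by
  have key : ∀ ε > 0, f t ≤ b + ε * t := by
    intro ε hε
    refine image_le_of_deriv_right_lt_deriv_boundary (f := f) (f' := f') (a := 0) (b := T)
      (B := fun t => b + ε * t) (B' := fun _ => ε) (fun t ht => (hf t ht).continuousWithinAt)
      (fun t ht => ?_) (by simpa using h0) (fun t => ?_) (fun t ht h => ?_) ht
    · refine (hf t ⟨ht.1, ht.2.le⟩).mono_of_mem_nhdsWithin ?_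
      exact mem_nhdsWithin_of_mem_nhds (Iic_mem_nhds ht.2) |> fun h =>
        Filter.inter_mem (mem_nhdsWithin.2 ⟨Set.univ, isOpen_univ, trivial,
          fun x hx => ht.1.trans hx.2⟩) h
    · simpa using ((hasDerivAt_id t).const_mul ε).const_add b
    · have : f' t ≤ 0 := hle t ⟨ht.1, ht.2.le⟩ (by rw [h]; nlinarith [ht.1])
      exact this.trans_lt hε
  refine le_of_forall_pos_le_add fun ε hε => ?_
  have h1 := key (ε / (t + 1)) (div_pos hε (by linarith [ht.1]))
  have h2 : ε / (t + 1) * t ≤ ε := by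
    rw [div_mul_eq_mul_div, div_le_iff₀ (by linarith [ht.1])]
    nlinarith [ht.1]
  linarith

/-- If a curve and its velocity converge, then the velocity tends to zero. -/
theorem eq_zero_of_tendsto_deriv {G : Type*} [NormedAddCommGroup G] [NormedSpace ℝ G]
    {f f' : ℝ → G} {y z : G}
    (hf : ∀ t ∈ Set.Ici (0 : ℝ), HasDerivWithinAt f (f' t) (Set.Ici 0) t)
    (hy : Filter.Tendsto f Filter.atTop (nhds y))
    (hz : Filter.Tendsto f' Filter.atTop (nhds z)) : z = 0 := by
  have h1 : Filter.Tendsto (fun t => f (t + 1) - f t) Filter.atTop (nhds (y - y)) :=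
    (hy.comp (Filter.tendsto_atTop_add_const_right _ 1 Filter.tendsto_id)).sub hy
  have h2 : Filter.Tendsto (fun t => f (t + 1) - f t) Filter.atTop (nhds z) := by
    rw [Metric.tendsto_atTop]
    intro ε hε
    obtain ⟨N, hN⟩ := Metric.tendsto_atTop.1 hz (ε / 2) (half_pos hε)
    refine ⟨max N 0, fun t ht => ?_⟩
    have ht0 : 0 ≤ t := (le_max_right _ _).trans ht
    have hd : ∀ x ∈ Set.Icc t (t + 1), HasDerivWithinAt (fun x => f x - x • z)
        (f' x - (1 : ℝ) • z) (Set.Icc t (t + 1)) x := fun x hx =>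
      ((hf x (ht0.trans hx.1)).mono (fun y hy => ht0.trans hy.1)).sub
        ((hasDerivWithinAt_id x _).smul_const z)
    have := (convex_Icc t (t + 1)).norm_image_sub_le_of_norm_hasDerivWithin_le hd
      (C := ε / 2) (fun x hx => by
        rw [one_smul, ← dist_eq_norm]
        exact (hN x (((le_max_left _ _).trans ht).trans hx.1)).le)
      (Set.left_mem_Icc.2 (by linarith)) (Set.right_mem_Icc.2 (by linarith))
    rw [dist_eq_norm]
    have e : f (t + 1) - f t - z = f (t + 1) - (t + 1) • z - (f t - t • z) := by
      rw [add_smul, one_smul]; abel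
    rw [e]
    simp at this
    simp
    linarith
  rw [sub_self] at h1
  exact tendsto_nhds_unique h2 h1

end scalar

section dot

variable {V : Type*} [Fintype V]

theorem abs_dotProduct_le (a b : V → ℝ) : |a ⬝ᵥ b| ≤ Fintype.card V * (‖a‖ * ‖b‖) := by
  rw [dotProduct]
  refine (Finset.abs_sum_le_sum_abs _ _).trans ?_
  refine (Finset.sum_le_card_nsmul _ _ (‖a‖ * ‖b‖) fun i _ => ?_).trans (by simp)
  rw [abs_mul]
  exact mul_le_mul (norm_le_pi_norm a i) (norm_le_pi_norm b i) (abs_nonneg _) (norm_nonneg _)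

theorem norm_sq_le_dotProduct (w : V → ℝ) : ‖w‖ ^ 2 ≤ w ⬝ᵥ w := by
  have h0 : 0 ≤ w ⬝ᵥ w := by
    rw [dotProduct]; exact Finset.sum_nonneg fun i _ => mul_self_nonneg _
  have : ‖w‖ ≤ √(w ⬝ᵥ w) := by
    refine (pi_norm_le_iff_of_nonneg (Real.sqrt_nonneg _)).2 fun i => ?_
    refine Real.le_sqrt_of_sq_le ?_
    rw [Real.norm_eq_abs, sq_abs, sq, dotProduct]
    exact Finset.single_le_sum (f := fun i => w i * w i) (fun i _ => mul_self_nonneg _)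
      (Finset.mem_univ i)
  calc ‖w‖ ^ 2 ≤ √(w ⬝ᵥ w) ^ 2 := by gcongr
    _ = w ⬝ᵥ w := Real.sq_sqrt h0

theorem hasDerivWithinAt_dotProduct {f g : ℝ → V → ℝ} {f' g' : V → ℝ} {s : Set ℝ} {t : ℝ}
    (hf : HasDerivWithinAt f f' s t) (hg : HasDerivWithinAt g g' s t) :
    HasDerivWithinAt (fun t => f t ⬝ᵥ g t) (f' ⬝ᵥ g t + f t ⬝ᵥ g') s t := by
  have hf' := hasDerivWithinAt_pi.1 hf
  have hg' := hasDerivWithinAt_pi.1 hg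
  simp only [dotProduct, ← Finset.sum_add_distrib]
  exact HasDerivWithinAt.fun_sum fun i _ => (hf' i).fun_mul (hg' i)

end dot

section flux

variable {V S : Type*} [Fintype V] [Fintype S] [DecidableEq V]

/-- The nonlinear operator `k ↦ (∑ β (ξ kᵢ + φ (kᵢ - kⱼ)))ᵢ` of a weighted graph with edges `S`,
where the sum is over the edges `ij` at `i` (with multiplicity); `P s` and `Q s` are the two ends of
the edge `s`. -/
def flux (P Q : S → V) (β ξ : S → ℝ) (φ : ℝ → ℝ) (k : V → ℝ) : V → ℝ :=
  ∑ s, (Pi.single (P s) (β s * (ξ s * k (P s) + φ (k (P s) - k (Q s)))) +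
    Pi.single (Q s) (β s * (ξ s * k (Q s) - φ (k (P s) - k (Q s)))))

variable {P Q : S → V} {β ξ : S → ℝ} {φ : ℝ → ℝ}

/-- Summation by parts. -/
theorem flux_dotProduct (k z : V → ℝ) : flux P Q β ξ φ k ⬝ᵥ z =
    ∑ s, (β s * ξ s * (k (P s) * z (P s) + k (Q s) * z (Q s)) +
      β s * (φ (k (P s) - k (Q s)) * (z (P s) - z (Q s)))) := by
  rw [flux, sum_dotProduct]
  refine Finset.sum_congr rfl fun s _ => ?_
  rw [add_dotProduct, single_dotProduct, single_dotProduct]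
  ring

/-- The linear case `φ = id` of `flux` as a continuous linear map. -/
def fluxCLM (P Q : S → V) (β ξ : S → ℝ) : (V → ℝ) →L[ℝ] (V → ℝ) :=
  LinearMap.toContinuousLinearMap
    { toFun := flux P Q β ξ id
      map_add' := fun x y => by
        simp only [flux, ← Finset.sum_add_distrib]
        refine Finset.sum_congr rfl fun s _ => ?_
        rw [add_add_add_comm, ← Pi.single_add, ← Pi.single_add]
        congr 2 <;> simp <;> ring
      map_smul' := fun c x => by
        simp only [flux, Finset.smul_sum, smul_add, RingHom.id_apply, ← Pi.single_smul]
        refine Finset.sum_congr rfl fun s _ => ?_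
        congr 2 <;> simp <;> ring }

theorem fluxCLM_apply (k : V → ℝ) : fluxCLM P Q β ξ k = flux P Q β ξ id k := rfl

theorem fluxCLM_symm (k z : V → ℝ) : fluxCLM P Q β ξ k ⬝ᵥ z = fluxCLM P Q β ξ z ⬝ᵥ k := by
  rw [fluxCLM_apply, fluxCLM_apply, flux_dotProduct, flux_dotProduct]
  refine Finset.sum_congr rfl fun s _ => ?_
  simp only [id]
  ring

/-- If `φ` is monotone, then `flux` is a monotone operator. -/
theorem flux_sub_dotProduct_nonneg (hβ : ∀ s, 0 ≤ β s) (hξ : ∀ s, 0 ≤ ξ s) (hφ : Monotone φ)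
    (k k' : V → ℝ) : 0 ≤ (k - k') ⬝ᵥ (flux P Q β ξ φ k - flux P Q β ξ φ k') := by
  rw [dotProduct_comm, sub_dotProduct, flux_dotProduct, flux_dotProduct, ← Finset.sum_sub_distrib]
  refine Finset.sum_nonneg fun s _ => ?_
  simp only [Pi.sub_apply]
  have h1 : 0 ≤ (φ (k (P s) - k (Q s)) - φ (k' (P s) - k' (Q s))) *
      ((k (P s) - k (Q s)) - (k' (P s) - k' (Q s))) := by
    rcases le_total (k (P s) - k (Q s)) (k' (P s) - k' (Q s)) with h | h
    · exact mul_nonneg_of_nonpos_of_nonpos (sub_nonpos.2 (hφ h)) (sub_nonpos.2 h)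
    · exact mul_nonneg (sub_nonneg.2 (hφ h)) (sub_nonneg.2 h)
  have h2 := mul_nonneg (hβ s) h1
  have h3 : 0 ≤ β s * ξ s * ((k (P s) - k' (P s)) ^ 2 + (k (Q s) - k' (Q s)) ^ 2) :=
    mul_nonneg (mul_nonneg (hβ s) (hξ s)) (by positivity)
  nlinarith

/-- The total weight `∑ β ξ` of the edge ends at `i`. -/
def vertexWeight (P Q : S → V) (β ξ : S → ℝ) (i : V) : ℝ :=
  ∑ s, ((if P s = i then β s * ξ s else 0) + if Q s = i then β s * ξ s else 0)

/-- The gradient part of `flux` is dissipative, so that `⟪flux k, k⟫` is at least its potential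
part. -/
theorem sum_vertexWeight_mul_sq_le (hβ : ∀ s, 0 ≤ β s) (hφ : Monotone φ) (hφ0 : φ 0 = 0)
    (k : V → ℝ) : ∑ i, vertexWeight P Q β ξ i * k i ^ 2 ≤ flux P Q β ξ φ k ⬝ᵥ k := by
  have h : ∑ i, vertexWeight P Q β ξ i * k i ^ 2 =
      ∑ s, β s * ξ s * (k (P s) * k (P s) + k (Q s) * k (Q s)) := by
    simp only [vertexWeight, Finset.sum_mul]
    rw [Finset.sum_comm]
    refine Finset.sum_congr rfl fun s _ => ?_
    simp only [add_mul, ite_mul, zero_mul, Finset.sum_add_distrib, Finset.sum_ite_eq,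
      Finset.mem_univ, if_true]
    ring
  rw [h, flux_dotProduct]
  refine Finset.sum_le_sum fun s _ => ?_
  have h1 : 0 ≤ φ (k (P s) - k (Q s)) * (k (P s) - k (Q s)) := by
    rcases le_total (k (P s) - k (Q s)) 0 with h | h
    · exact mul_nonneg_of_nonpos_of_nonpos (hφ0 ▸ hφ h) h
    · exact mul_nonneg (hφ0 ▸ hφ h) h
  linarith [mul_nonneg (hβ s) h1]

omit [Fintype V] in
theorem flux_apply (k : V → ℝ) (i : V) : flux P Q β ξ φ k i =
    ∑ s, ((if P s = i then β s * (ξ s * k (P s) + φ (k (P s) - k (Q s))) else 0) +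
      if Q s = i then β s * (ξ s * k (Q s) - φ (k (P s) - k (Q s))) else 0) := by
  simp only [flux, Finset.sum_apply, Pi.add_apply, Pi.single_apply, eq_comm]

end flux

end CirclePacking

/-! ### Curvature systems -/

namespace CirclePacking
open Filter Topology

/-- The open orthant of functions with negative values; it is the range of the logarithmic radius
coordinates `log (tanh (r / 2))`. -/
def negOrthant (V : Type*) : Set (V → ℝ) := {u | ∀ i, u i < 0}

theorem isOpen_negOrthant (V : Type*) [Finite V] : IsOpen (negOrthant V) := by
  have : negOrthant V = Set.pi Set.univ fun _ => Set.Iio 0 := by ext u; simp [negOrthant]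
  rw [this]
  exact isOpen_set_pi Set.finite_univ fun _ _ => isOpen_Iio

theorem convex_negOrthant (V : Type*) : Convex ℝ (negOrthant V) := by
  have : negOrthant V = Set.pi Set.univ fun _ => Set.Iio 0 := by ext u; simp [negOrthant]
  rw [this]
  exact convex_pi fun _ _ => convex_Iio 0

theorem exists_pos_forall_le {ι E : Type*} [Finite ι] [TopologicalSpace E] {Q : Set E}
    (hQ : IsCompact Q) {f : ι → E → ℝ} (hf : ∀ i, ContinuousOn (f i) Q)
    (hpos : ∀ i, ∀ u ∈ Q, 0 < f i u) : ∃ c > 0, ∀ i, ∀ u ∈ Q, c ≤ f i u := by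
  have h : ∀ i, ∃ c > 0, ∀ u ∈ Q, c ≤ f i u := by
    intro i
    rcases Q.eq_empty_or_nonempty with rfl | hne
    · exact ⟨1, one_pos, by simp⟩
    · obtain ⟨x, hx, hmin⟩ := hQ.exists_isMinOn hne (hf i)
      exact ⟨f i x, hpos i x hx, fun u hu => hmin hu⟩
  choose c hc hcf using h
  have hev : ∀ᶠ b in 𝓝[>] (0 : ℝ), 0 < b ∧ ∀ i, b ≤ c i := by
    refine Eventually.and self_mem_nhdsWithin (eventually_all.2 fun i => ?_)
    exact mem_nhdsWithin_of_mem_nhds (Iic_mem_nhds (hc i))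
  obtain ⟨b, hb, hbc⟩ := hev.exists
  exact ⟨b, hb, fun i u hu => (hbc i).trans (hcf i u hu)⟩

/-- The compact convex set is a box. -/
theorem exists_compact_convex_superset {V : Type*} [Fintype V] {W : Set (V → ℝ)}
    (hW : IsCompact W) (hWU : W ⊆ negOrthant V) :
    ∃ Y, IsCompact Y ∧ Convex ℝ Y ∧ Y ⊆ negOrthant V ∧ W ⊆ Y := by
  obtain ⟨m, hm, hmW⟩ := exists_pos_forall_le hW (f := fun (i : V) u => -u i)
    (fun i => (continuous_apply i).neg.continuousOn) (fun i u hu => neg_pos.2 (hWU hu i))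
  obtain ⟨M, hM⟩ := hW.exists_bound_of_continuousOn continuousOn_id
  refine ⟨Set.Icc (fun _ => -M) (fun _ => -m), isCompact_Icc, convex_Icc _ _, fun u hu i => ?_,
    fun u hu => ⟨fun i => ?_, fun i => ?_⟩⟩
  · exact (hu.2 i).trans_lt (neg_lt_zero.2 hm)
  · exact (abs_le.1 ((norm_le_pi_norm u i).trans (hM u hu))).1
  · linarith [hmW i u hu]

/-- The structural properties of the curvature map of circle packings in logarithmic radius
coordinates `u`: its derivative is the operator `flux` with `φ = id` of a weighted graph whose
weights depend smoothly on `u`. -/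
structure CurvatureSystem (V S : Type*) [Fintype V] [Fintype S] [DecidableEq V] where
  /-- the first end of an edge -/
  P : S → V
  /-- the second end of an edge -/
  Q : S → V
  /-- the weight of an edge -/
  β : S → (V → ℝ) → ℝ
  /-- the ratio between the potential and the gradient part of an edge -/
  ξ : S → (V → ℝ) → ℝ
  /-- the curvature -/
  K : (V → ℝ) → V → ℝ
  contDiffOn_β : ∀ s, ContDiffOn ℝ 1 (β s) (negOrthant V)
  contDiffOn_ξ : ∀ s, ContDiffOn ℝ 1 (ξ s) (negOrthant V)
  β_nonneg : ∀ s, ∀ u ∈ negOrthant V, 0 ≤ β s u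
  ξ_pos : ∀ s, ∀ u ∈ negOrthant V, 0 < ξ s u
  /-- every vertex has an edge of positive weight -/
  exists_β_pos : ∀ u ∈ negOrthant V, ∀ i, ∃ s, (P s = i ∨ Q s = i) ∧ 0 < β s u
  hasFDerivAt_K : ∀ u ∈ negOrthant V,
    HasFDerivAt K (fluxCLM P Q (fun s => β s u) (fun s => ξ s u)) u
  exists_K_le : ∃ C, ∀ u ∈ negOrthant V, ∀ i, |K u i| ≤ C
  /-- large circles have curvature at least `1`, and the ratio `ξ` is large at them -/
  exists_barrier : ∀ M : ℝ, ∃ m > 0, ∀ u ∈ negOrthant V, ∀ i, -m ≤ u i →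
    1 ≤ K u i ∧ ∀ s, P s = i ∨ Q s = i → M ≤ ξ s u
  /-- the coefficients are bounded where the radii are -/
  exists_coeff_le : ∀ m > 0, ∃ C, ∀ u : V → ℝ, (∀ i, u i ≤ -m) → ∀ s, β s u ≤ C ∧ ξ s u ≤ C

namespace CurvatureSystem

variable {V S : Type*} [Fintype V] [Fintype S] [DecidableEq V] (Z : CurvatureSystem V S)

/-- The derivative of the curvature. -/
def dK (u : V → ℝ) : (V → ℝ) →L[ℝ] (V → ℝ) :=
  fluxCLM Z.P Z.Q (fun s => Z.β s u) (fun s => Z.ξ s u)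

/-- The velocity field of the flow. -/
def velocity (φ : ℝ → ℝ) (u : V → ℝ) : V → ℝ :=
  -flux Z.P Z.Q (fun s => Z.β s u) (fun s => Z.ξ s u) φ (Z.K u)

theorem contDiffOn_dK : ContDiffOn ℝ 1 Z.dK (negOrthant V) := by
  have h : Z.dK = fun u => ∑ s, ((Z.β s u * Z.ξ s u) •
        ((ContinuousLinearMap.proj (R := ℝ) (φ := fun _ : V => ℝ) (Z.P s)).smulRight
            (Pi.single (Z.P s) (1 : ℝ) : V → ℝ) +
          (ContinuousLinearMap.proj (R := ℝ) (φ := fun _ : V => ℝ) (Z.Q s)).smulRight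
            (Pi.single (Z.Q s) (1 : ℝ) : V → ℝ)) +
      Z.β s u • (ContinuousLinearMap.proj (R := ℝ) (φ := fun _ : V => ℝ) (Z.P s) -
          ContinuousLinearMap.proj (R := ℝ) (φ := fun _ : V => ℝ) (Z.Q s)).smulRight
        (Pi.single (Z.P s) (1 : ℝ) - Pi.single (Z.Q s) (1 : ℝ) : V → ℝ)) := by
    ext1 u
    ext1 k
    rw [dK, fluxCLM_apply, flux, sum_apply]
    refine Finset.sum_congr rfl fun s _ => ?_
    ext i
    simp [Pi.single_apply]
    split_ifs <;> ring
  rw [h]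
  refine ContDiffOn.sum fun s _ => ?_
  exact (((Z.contDiffOn_β s).mul (Z.contDiffOn_ξ s)).smul contDiffOn_const).add
    ((Z.contDiffOn_β s).smul contDiffOn_const)

theorem continuousOn_K : ContinuousOn Z.K (negOrthant V) := fun u hu =>
  (Z.hasFDerivAt_K u hu).continuousAt.continuousWithinAt

theorem continuousOn_velocity {φ : ℝ → ℝ} (hφ : Continuous φ) :
    ContinuousOn (Z.velocity φ) (negOrthant V) := by
  refine ContinuousOn.neg (continuousOn_pi.2 fun i => ?_)
  simp only [flux_apply]
  have hk : ∀ i, ContinuousOn (fun u => Z.K u i) (negOrthant V) :=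
    fun i => (continuous_apply i).comp_continuousOn Z.continuousOn_K
  refine continuousOn_finsetSum _ fun s _ => ?_
  have hβ := (Z.contDiffOn_β s).continuousOn
  have hξ := (Z.contDiffOn_ξ s).continuousOn
  have hd := hφ.comp_continuousOn ((hk (Z.P s)).sub (hk (Z.Q s)))
  refine ContinuousOn.add ?_ ?_
  · split_ifs
    · exact hβ.mul ((hξ.mul (hk _)).add hd)
    · exact continuousOn_const
  · split_ifs
    · exact hβ.mul ((hξ.mul (hk _)).sub hd)
    · exact continuousOn_const

theorem vertexWeight_pos {u : V → ℝ} (hu : u ∈ negOrthant V) (i : V) :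
    0 < vertexWeight Z.P Z.Q (fun s => Z.β s u) (fun s => Z.ξ s u) i := by
  obtain ⟨s, hs, hβ⟩ := Z.exists_β_pos u hu i
  have h0 : ∀ s, 0 ≤ Z.β s u * Z.ξ s u :=
    fun s => mul_nonneg (Z.β_nonneg s u hu) (Z.ξ_pos s u hu).le
  have hp : 0 < Z.β s u * Z.ξ s u := mul_pos hβ (Z.ξ_pos s u hu)
  refine Finset.sum_pos' (fun s _ => ?_) ⟨s, Finset.mem_univ s, ?_⟩
  · have := h0 s
    split_ifs <;> linarith
  · rcases hs with hs | hs <;> rw [if_pos hs] <;> split_ifs <;> linarith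

/-- On compact sets the operators `flux` are uniformly coercive. -/
theorem exists_coercive {Y : Set (V → ℝ)} (hY : IsCompact Y) (hYU : Y ⊆ negOrthant V) :
    ∃ c > 0, ∀ φ : ℝ → ℝ, Monotone φ → φ 0 = 0 → ∀ u ∈ Y, ∀ k : V → ℝ,
      c * (k ⬝ᵥ k) ≤ flux Z.P Z.Q (fun s => Z.β s u) (fun s => Z.ξ s u) φ k ⬝ᵥ k := by
  obtain ⟨c, hc, hcw⟩ := exists_pos_forall_le hY
    (f := fun i u => vertexWeight Z.P Z.Q (fun s => Z.β s u) (fun s => Z.ξ s u) i)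
    (fun i => by
      simp only [vertexWeight]
      refine continuousOn_finsetSum _ fun s _ => ?_
      have hβ := (Z.contDiffOn_β s).continuousOn.mono hYU
      have hξ := (Z.contDiffOn_ξ s).continuousOn.mono hYU
      refine ContinuousOn.add ?_ ?_ <;> split_ifs
      exacts [hβ.mul hξ, continuousOn_const, hβ.mul hξ, continuousOn_const])
    (fun i u hu => Z.vertexWeight_pos (hYU hu) i)
  refine ⟨c, hc, fun φ hφ hφ0 u hu k => ?_⟩
  refine le_trans ?_ (sum_vertexWeight_mul_sq_le (fun s => Z.β_nonneg s u (hYU hu)) hφ hφ0 k)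
  rw [dotProduct, Finset.mul_sum]
  refine Finset.sum_le_sum fun i _ => ?_
  rw [← sq]
  exact mul_le_mul_of_nonneg_right (hcw i u hu) (sq_nonneg _)

/-- The derivative of `s ↦ ⟪K (x + s w), w⟫`. -/
theorem hasDerivAt_K_line {x w : V → ℝ} {s : ℝ} (h : x + s • w ∈ negOrthant V) :
    HasDerivAt (fun s : ℝ => Z.K (x + s • w) ⬝ᵥ w) (Z.dK (x + s • w) w ⬝ᵥ w) s := by
  have h1 : HasDerivAt (fun s : ℝ => x + s • w) w s := by
    simpa using ((hasDerivAt_id s).smul_const w).const_add x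
  have h2 := (Z.hasFDerivAt_K _ h).comp_hasDerivAt s h1
  have h3 := h2.hasDerivWithinAt (s := Set.univ)
  have := hasDerivWithinAt_dotProduct h3 (hasDerivWithinAt_const s Set.univ w)
  refine (this.hasDerivAt univ_mem).congr_deriv ?_
  rw [dotProduct_zero, add_zero]
  rfl

/-- The curvature is a strongly monotone function on compact convex sets. -/
theorem exists_strongly_monotone {Y : Set (V → ℝ)} (hY : IsCompact Y) (hc : Convex ℝ Y)
    (hYU : Y ⊆ negOrthant V) :
    ∃ c > 0, ∀ x ∈ Y, ∀ y ∈ Y, c * ((y - x) ⬝ᵥ (y - x)) ≤ (Z.K y - Z.K x) ⬝ᵥ (y - x) := by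
  obtain ⟨c, hc0, hcoer⟩ := Z.exists_coercive hY hYU
  refine ⟨c, hc0, fun x hx y hy => ?_⟩
  have hmem : ∀ s ∈ Set.Icc (0 : ℝ) 1, x + s • (y - x) ∈ Y :=
    fun s hs => hc.add_smul_sub_mem hx hy hs
  have hd : ∀ s ∈ Set.Icc (0 : ℝ) 1, HasDerivAt
      (fun s : ℝ => Z.K (x + s • (y - x)) ⬝ᵥ (y - x) - s * (c * ((y - x) ⬝ᵥ (y - x))))
      (Z.dK (x + s • (y - x)) (y - x) ⬝ᵥ (y - x) - c * ((y - x) ⬝ᵥ (y - x))) s := by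
    intro s hs
    refine ((Z.hasDerivAt_K_line (hYU (hmem s hs))).fun_sub
      ((hasDerivAt_id s).mul_const (c * ((y - x) ⬝ᵥ (y - x))))).congr_deriv ?_
    rw [one_mul]
  have hmono : MonotoneOn
      (fun s : ℝ => Z.K (x + s • (y - x)) ⬝ᵥ (y - x) - s * (c * ((y - x) ⬝ᵥ (y - x))))
      (Set.Icc 0 1) := by
    refine monotoneOn_of_hasDerivWithinAt_nonneg (convex_Icc 0 1)
      (fun s hs => (hd s hs).continuousAt.continuousWithinAt)
      (fun s hs => (hd s (interior_subset hs)).hasDerivWithinAt) fun s hs => ?_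
    have := hcoer id monotone_id rfl _ (hmem s (interior_subset hs)) (y - x)
    exact sub_nonneg.2 this
  have := hmono (Set.left_mem_Icc.2 zero_le_one) (Set.right_mem_Icc.2 zero_le_one) zero_le_one
  simp only [zero_smul, add_zero, zero_mul, sub_zero, one_smul, add_sub_cancel, one_mul] at this
  rw [sub_dotProduct (Z.K y)]
  linarith

end CurvatureSystem

end CirclePacking

/-! ### Uniqueness of solutions -/

namespace CirclePacking
open Filter Topology

theorem abs_le_of_monotone_of_abs_le {φ : ℝ → ℝ} (hφ : Monotone φ) {t c : ℝ} (h : |t| ≤ c) :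
    |φ t| ≤ |φ (-c)| + |φ c| := by
  have h1 := hφ (abs_le.1 h).1
  have h2 := hφ (abs_le.1 h).2
  rw [abs_le]
  constructor <;>
  linarith [neg_abs_le (φ (-c)), neg_abs_le (φ c), le_abs_self (φ c), le_abs_self (φ (-c))]

namespace CurvatureSystem

variable {V S : Type*} [Fintype V] [Fintype S] [DecidableEq V] (Z : CurvatureSystem V S)
variable {Y : Set (V → ℝ)}

theorem exists_K_lipschitz (hY : IsCompact Y) (hc : Convex ℝ Y) (hYU : Y ⊆ negOrthant V) :
    ∃ C ≥ 0, ∀ x ∈ Y, ∀ y ∈ Y, ‖Z.K x - Z.K y‖ ≤ C * ‖x - y‖ := by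
  obtain ⟨C, hC⟩ := hY.exists_bound_of_continuousOn (Z.contDiffOn_dK.continuousOn.mono hYU)
  refine ⟨max C 0, le_max_right _ _, fun x hx y hy => ?_⟩
  exact hc.norm_image_sub_le_of_norm_hasFDerivWithin_le
    (fun z hz => (Z.hasFDerivAt_K z (hYU hz)).hasFDerivWithinAt)
    (fun z hz => (hC z hz).trans (le_max_left _ _)) hy hx

/-- A Taylor estimate of second order for the curvature, expanded at `x`. -/
theorem exists_K_taylor (hY : IsCompact Y) (hc : Convex ℝ Y) (hYU : Y ⊆ negOrthant V) :
    ∃ C ≥ 0, ∀ x ∈ Y, ∀ y ∈ Y, ‖Z.dK x (x - y) - (Z.K x - Z.K y)‖ ≤ C * ‖x - y‖ ^ 2 := by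
  obtain ⟨L, hL⟩ := (Z.contDiffOn_dK.mono hYU).exists_lipschitzOnWith one_ne_zero hc hY
  refine ⟨L, L.2, fun x hx y hy => ?_⟩
  have := ((hc.inter (convex_closedBall x ‖x - y‖))).norm_image_sub_le_of_norm_hasFDerivWithin_le'
    (f := Z.K) (f' := Z.dK) (φ := Z.dK x) (C := L * ‖x - y‖) (x := y) (y := x)
    (fun z hz => (Z.hasFDerivAt_K z (hYU hz.1)).hasFDerivWithinAt)
    (fun z hz => by
      refine (hL.norm_sub_le hz.1 hx).trans ?_
      have := mem_closedBall_iff_norm.1 hz.2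
      gcongr)
    ⟨hy, by rw [mem_closedBall_iff_norm, norm_sub_rev]⟩
    ⟨hx, Metric.mem_closedBall_self (norm_nonneg _)⟩
  rw [norm_sub_rev]
  rwa [mul_assoc, ← sq] at this

/-- The dependence of `flux` on its coefficients, with the curvature in its argument held fixed, is
Lipschitz; no regularity of `φ` is involved. -/
theorem exists_flux_lipschitz {φ : ℝ → ℝ} (hφ : Monotone φ) (hY : IsCompact Y) (hc : Convex ℝ Y)
    (hYU : Y ⊆ negOrthant V) :
    ∃ C ≥ 0, ∀ x ∈ Y, ∀ y ∈ Y, ∀ z : V → ℝ,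
      |(flux Z.P Z.Q (fun s => Z.β s x) (fun s => Z.ξ s x) φ (Z.K y) -
        flux Z.P Z.Q (fun s => Z.β s y) (fun s => Z.ξ s y) φ (Z.K y)) ⬝ᵥ z| ≤
      C * (‖x - y‖ * ‖z‖) := by
  obtain ⟨M, hM⟩ := Z.exists_K_le
  have h : ∀ s, ∃ C ≥ 0, ∀ x ∈ Y, ∀ y ∈ Y, ∀ z : V → ℝ,
      |(Z.β s x * Z.ξ s x - Z.β s y * Z.ξ s y) *
          (Z.K y (Z.P s) * z (Z.P s) + Z.K y (Z.Q s) * z (Z.Q s)) +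
        (Z.β s x - Z.β s y) * (φ (Z.K y (Z.P s) - Z.K y (Z.Q s)) * (z (Z.P s) - z (Z.Q s)))| ≤
      C * (‖x - y‖ * ‖z‖) := by
    intro s
    obtain ⟨L₁, hL₁⟩ := ((Z.contDiffOn_β s).mono hYU).exists_lipschitzOnWith one_ne_zero hc hY
    obtain ⟨L₂, hL₂⟩ := (((Z.contDiffOn_β s).mul (Z.contDiffOn_ξ s)).mono
      hYU).exists_lipschitzOnWith one_ne_zero hc hY
    refine ⟨L₂ * (2 * |M|) + L₁ * ((|φ (-(2 * M))| + |φ (2 * M)|) * 2), by positivity,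
      fun x hx y hy z => ?_⟩
    have a1 : |Z.β s x - Z.β s y| ≤ L₁ * ‖x - y‖ := hL₁.norm_sub_le hx hy
    have a2 : |Z.β s x * Z.ξ s x - Z.β s y * Z.ξ s y| ≤ L₂ * ‖x - y‖ := hL₂.norm_sub_le hx hy
    have b1 : |Z.K y (Z.P s)| ≤ M := hM y (hYU hy) _
    have b2 : |Z.K y (Z.Q s)| ≤ M := hM y (hYU hy) _
    have hMM := le_abs_self M
    have z1 : |z (Z.P s)| ≤ ‖z‖ := norm_le_pi_norm z _
    have z2 : |z (Z.Q s)| ≤ ‖z‖ := norm_le_pi_norm z _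
    have b3 : |φ (Z.K y (Z.P s) - Z.K y (Z.Q s))| ≤ |φ (-(2 * M))| + |φ (2 * M)| :=
      abs_le_of_monotone_of_abs_le hφ ((abs_sub _ _).trans (by linarith))
    have c1 : |Z.K y (Z.P s) * z (Z.P s) + Z.K y (Z.Q s) * z (Z.Q s)| ≤ 2 * |M| * ‖z‖ := by
      refine (abs_add_le _ _).trans ?_
      rw [abs_mul, abs_mul]
      have h1 : |Z.K y (Z.P s)| * |z (Z.P s)| ≤ |M| * ‖z‖ :=
        mul_le_mul (b1.trans hMM) z1 (abs_nonneg _) (abs_nonneg _)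
      have h2 : |Z.K y (Z.Q s)| * |z (Z.Q s)| ≤ |M| * ‖z‖ :=
        mul_le_mul (b2.trans hMM) z2 (abs_nonneg _) (abs_nonneg _)
      linarith
    have c2 : |φ (Z.K y (Z.P s) - Z.K y (Z.Q s)) * (z (Z.P s) - z (Z.Q s))| ≤
        (|φ (-(2 * M))| + |φ (2 * M)|) * (2 * ‖z‖) := by
      rw [abs_mul]
      exact mul_le_mul b3 ((abs_sub _ _).trans (by linarith)) (abs_nonneg _) (by positivity)
    refine (abs_add_le _ _).trans ?_
    rw [abs_mul, abs_mul (Z.β s x - Z.β s y)]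
    have d1 := mul_le_mul a2 c1 (abs_nonneg _) (by positivity)
    have d2 := mul_le_mul a1 c2 (abs_nonneg _) (by positivity)
    linarith
  choose C hC0 hC using h
  refine ⟨∑ s, C s, Finset.sum_nonneg fun s _ => hC0 s, fun x hx y hy z => ?_⟩
  rw [sub_dotProduct, flux_dotProduct, flux_dotProduct, ← Finset.sum_sub_distrib, Finset.sum_mul]
  refine (Finset.abs_sum_le_sum_abs _ _).trans (Finset.sum_le_sum fun s _ => ?_)
  refine le_trans (le_of_eq ?_) (hC s x hx y hy z)
  congr 1
  ring

/-- Solutions are unique. The function `φ` need not be Lipschitz; instead, the quantity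
`⟪K(u) - K(v), u - v⟫`, which is comparable with `‖u - v‖²`, satisfies a Gronwall inequality along
two solutions `u`, `v`: its derivative consists of second-order terms and of the term
`2 ⟪K(u) - K(v), u' - v'⟫`, where the contribution of `φ` has the good sign by monotonicity. -/
theorem solution_unique {φ : ℝ → ℝ} (hφ : Monotone φ) (hφc : Continuous φ) {u v : ℝ → V → ℝ}
    {T : ℝ}
    (hu : ∀ t ∈ Set.Icc 0 T, HasDerivWithinAt u (Z.velocity φ (u t)) (Set.Icc 0 T) t)
    (hv : ∀ t ∈ Set.Icc 0 T, HasDerivWithinAt v (Z.velocity φ (v t)) (Set.Icc 0 T) t)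
    (huU : ∀ t ∈ Set.Icc 0 T, u t ∈ negOrthant V) (hvU : ∀ t ∈ Set.Icc 0 T, v t ∈ negOrthant V)
    (h0 : u 0 = v 0) : Set.EqOn u v (Set.Icc 0 T) := by
  have huc : ContinuousOn u (Set.Icc 0 T) := fun t ht => (hu t ht).continuousWithinAt
  have hvc : ContinuousOn v (Set.Icc 0 T) := fun t ht => (hv t ht).continuousWithinAt
  obtain ⟨Y, hY, hc, hYU, hWY⟩ := exists_compact_convex_superset
    ((isCompact_Icc.image_of_continuousOn huc).union (isCompact_Icc.image_of_continuousOn hvc))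
    (by
      rintro x (⟨t, ht, rfl⟩ | ⟨t, ht, rfl⟩)
      exacts [huU t ht, hvU t ht])
  have huY : ∀ t ∈ Set.Icc 0 T, u t ∈ Y := fun t ht => hWY (Or.inl ⟨t, ht, rfl⟩)
  have hvY : ∀ t ∈ Set.Icc 0 T, v t ∈ Y := fun t ht => hWY (Or.inr ⟨t, ht, rfl⟩)
  obtain ⟨c, hc0, hmono⟩ := Z.exists_strongly_monotone hY hc hYU
  obtain ⟨C₁, hC₁, hK⟩ := Z.exists_K_lipschitz hY hc hYU
  obtain ⟨C₂, hC₂, hT⟩ := Z.exists_K_taylor hY hc hYU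
  obtain ⟨C₃, hC₃, hF⟩ := Z.exists_flux_lipschitz hφ hY hc hYU
  obtain ⟨B, hB⟩ := hY.exists_bound_of_continuousOn ((Z.continuousOn_velocity hφc).mono hYU)
  set N : ℝ := (Fintype.card V : ℝ)
  have hN : 0 ≤ N := Nat.cast_nonneg _
  -- two Taylor remainders, and twice the variation of the coefficients of `flux`
  set D := 2 * (N * (C₂ * |B|)) + 2 * (C₃ * C₁) with hD
  have hD0 : 0 ≤ D := by positivity
  set f : ℝ → ℝ := fun t => (Z.K (u t) - Z.K (v t)) ⬝ᵥ (u t - v t) with hf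
  set f' : ℝ → ℝ := fun t =>
    (Z.dK (u t) (Z.velocity φ (u t)) - Z.dK (v t) (Z.velocity φ (v t))) ⬝ᵥ (u t - v t) +
      (Z.K (u t) - Z.K (v t)) ⬝ᵥ (Z.velocity φ (u t) - Z.velocity φ (v t)) with hf'
  have hd : ∀ t ∈ Set.Icc 0 T, HasDerivWithinAt f (f' t) (Set.Icc 0 T) t := fun t ht =>
    hasDerivWithinAt_dotProduct
      (((Z.hasFDerivAt_K _ (huU t ht)).comp_hasDerivWithinAt t (hu t ht)).sub
        ((Z.hasFDerivAt_K _ (hvU t ht)).comp_hasDerivWithinAt t (hv t ht)))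
      ((hu t ht).sub (hv t ht))
  have hfc : ∀ t ∈ Set.Icc 0 T, c * ‖u t - v t‖ ^ 2 ≤ f t := fun t ht =>
    (mul_le_mul_of_nonneg_left (norm_sq_le_dotProduct _) hc0.le).trans
      (hmono _ (hvY t ht) _ (huY t ht))
  have hle : ∀ t ∈ Set.Icc 0 T, f' t ≤ D / c * f t := by
    intro t ht
    have hut := huY t ht
    have hvt := hvY t ht
    have hb1 := hB _ hut
    have hb2 := hB _ hvt
    -- the symmetry of `dK` turns the derivative into two Taylor remainders and the monotone term
    have hsplit : f' t =
        (Z.dK (u t) (u t - v t) - (Z.K (u t) - Z.K (v t))) ⬝ᵥ Z.velocity φ (u t) +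
        (Z.dK (v t) (v t - u t) - (Z.K (v t) - Z.K (u t))) ⬝ᵥ Z.velocity φ (v t) +
        2 * ((Z.K (u t) - Z.K (v t)) ⬝ᵥ (Z.velocity φ (u t) - Z.velocity φ (v t))) := by
      have e1 : Z.dK (u t) (Z.velocity φ (u t)) ⬝ᵥ (u t - v t) =
        Z.dK (u t) (u t - v t) ⬝ᵥ Z.velocity φ (u t) := fluxCLM_symm _ _
      have e2 : Z.dK (v t) (Z.velocity φ (v t)) ⬝ᵥ (u t - v t) =
        Z.dK (v t) (u t - v t) ⬝ᵥ Z.velocity φ (v t) := fluxCLM_symm _ _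
      have e3 : Z.dK (v t) (v t - u t) = -Z.dK (v t) (u t - v t) := by
        rw [← map_neg, neg_sub]
      simp only [hf', e3]
      rw [sub_dotProduct (Z.dK (u t) _), e1, e2]
      simp only [sub_dotProduct, dotProduct_sub, neg_dotProduct]
      ring
    have k1 : (Z.dK (u t) (u t - v t) - (Z.K (u t) - Z.K (v t))) ⬝ᵥ Z.velocity φ (u t) ≤
        N * (C₂ * |B|) * ‖u t - v t‖ ^ 2 := by
      refine (le_abs_self _).trans ((abs_dotProduct_le _ _).trans ?_)
      calc N * (_ * _) ≤ N * ((C₂ * ‖u t - v t‖ ^ 2) * |B|) := by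
            gcongr
            exacts [hT _ hut _ hvt, hb1.trans (le_abs_self B)]
        _ = _ := by ring
    have k2 : (Z.dK (v t) (v t - u t) - (Z.K (v t) - Z.K (u t))) ⬝ᵥ Z.velocity φ (v t) ≤
        N * (C₂ * |B|) * ‖u t - v t‖ ^ 2 := by
      refine (le_abs_self _).trans ((abs_dotProduct_le _ _).trans ?_)
      rw [norm_sub_rev (u t)]
      calc N * (_ * _) ≤ N * ((C₂ * ‖v t - u t‖ ^ 2) * |B|) := by
            gcongr
            exacts [hT _ hvt _ hut, hb2.trans (le_abs_self B)]
        _ = _ := by ring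
    have k3 : (Z.K (u t) - Z.K (v t)) ⬝ᵥ (Z.velocity φ (u t) - Z.velocity φ (v t)) ≤
        C₃ * C₁ * ‖u t - v t‖ ^ 2 := by
      have h1 := flux_sub_dotProduct_nonneg (P := Z.P) (Q := Z.Q)
        (fun s => Z.β_nonneg s _ (huU t ht)) (fun s => (Z.ξ_pos s _ (huU t ht)).le) hφ
        (Z.K (u t)) (Z.K (v t))
      have h2 := (neg_le_abs _).trans (hF _ hut _ hvt (Z.K (u t) - Z.K (v t)))
      have h3 := hK _ hut _ hvt
      have h4 : C₃ * (‖u t - v t‖ * ‖Z.K (u t) - Z.K (v t)‖) ≤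
          C₃ * (‖u t - v t‖ * (C₁ * ‖u t - v t‖)) := by gcongr
      simp only [velocity]
      rw [dotProduct_comm] at h1 ⊢
      simp only [sub_dotProduct, neg_dotProduct] at h1 h2 ⊢
      nlinarith
    have k4 := hfc t ht
    rw [hsplit, div_mul_eq_mul_div, le_div_iff₀ hc0]
    have k5 := mul_le_mul_of_nonneg_left k4 hD0
    have k6 : (Z.dK (u t) (u t - v t) - (Z.K (u t) - Z.K (v t))) ⬝ᵥ Z.velocity φ (u t) +
        (Z.dK (v t) (v t - u t) - (Z.K (v t) - Z.K (u t))) ⬝ᵥ Z.velocity φ (v t) +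
        2 * ((Z.K (u t) - Z.K (v t)) ⬝ᵥ (Z.velocity φ (u t) - Z.velocity φ (v t))) ≤
        D * ‖u t - v t‖ ^ 2 := by
      rw [hD]; linarith
    have := mul_le_mul_of_nonneg_right k6 hc0.le
    linarith
  intro t ht
  have h1 := le_mul_exp_of_deriv_le hd hle ht
  have h2 := hfc t ht
  have h3 : f 0 = 0 := by simp [hf, h0]
  rw [h3, zero_mul] at h1
  have h4 : ‖u t - v t‖ ^ 2 ≤ 0 := by
    by_contra! h
    have := mul_pos hc0 h
    linarith
  have h5 : ‖u t - v t‖ = 0 := by nlinarith [sq_nonneg ‖u t - v t‖]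
  exact sub_eq_zero.1 (norm_eq_zero.1 h5)

end CurvatureSystem

end CirclePacking

/-! ### Long-time existence and limits -/

namespace CirclePacking
open Filter Topology

namespace CurvatureSystem

variable {V S : Type*} [Fintype V] [Fintype S] [DecidableEq V] (Z : CurvatureSystem V S)
variable {φ : ℝ → ℝ}

omit [Fintype V] [DecidableEq V] in
theorem mem_negOrthant_of_le {u : V → ℝ} {m : ℝ} (hm : 0 < m) (hu : ∀ i, u i ≤ -m) :
    u ∈ negOrthant V := fun i => (hu i).trans_lt (neg_lt_zero.2 hm)

/-- Large circles do not grow. -/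
theorem exists_velocity_nonpos (hφ : Monotone φ) :
    ∃ m > 0, ∀ u ∈ negOrthant V, ∀ i, -m ≤ u i → Z.velocity φ u i ≤ 0 := by
  obtain ⟨M, hM⟩ := Z.exists_K_le
  obtain ⟨m, hm, hbar⟩ := Z.exists_barrier (|φ (-(2 * M))| + |φ (2 * M)|)
  refine ⟨m, hm, fun u hu i hi => ?_⟩
  obtain ⟨hK, hξ⟩ := hbar u hu i hi
  rw [velocity, Pi.neg_apply, neg_nonpos, flux_apply]
  refine Finset.sum_nonneg fun s _ => ?_
  have hβ := Z.β_nonneg s u hu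
  have b : |φ (Z.K u (Z.P s) - Z.K u (Z.Q s))| ≤ |φ (-(2 * M))| + |φ (2 * M)| :=
    abs_le_of_monotone_of_abs_le hφ
      ((abs_sub _ _).trans (by linarith [hM u hu (Z.P s), hM u hu (Z.Q s)]))
  have b' := abs_le.1 b
  have key : Z.P s = i ∨ Z.Q s = i → |φ (-(2 * M))| + |φ (2 * M)| ≤ Z.ξ s u * Z.K u i := by
    intro h
    have h1 := hξ s h
    have h2 : 0 ≤ |φ (-(2 * M))| + |φ (2 * M)| := by positivity
    nlinarith
  refine add_nonneg ?_ ?_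
  · split_ifs with h
    · have := key (Or.inl h)
      rw [← h] at this
      exact mul_nonneg hβ (by linarith)
    · exact le_rfl
  · split_ifs with h
    · have := key (Or.inr h)
      rw [← h] at this
      exact mul_nonneg hβ (by linarith)
    · exact le_rfl

/-- The velocity is bounded as long as the radii are. -/
theorem exists_velocity_le (hφ : Monotone φ) {m : ℝ} (hm : 0 < m) :
    ∃ C, ∀ u : V → ℝ, (∀ i, u i ≤ -m) → ‖Z.velocity φ u‖ ≤ C := by
  obtain ⟨M, hM⟩ := Z.exists_K_le
  obtain ⟨C, hC⟩ := Z.exists_coeff_le m hm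
  set B := |φ (-(2 * M))| + |φ (2 * M)| with hB
  refine ⟨∑ _s : S, (|C| * (|C| * |M| + B) + |C| * (|C| * |M| + B)), fun u hu => ?_⟩
  have huU := mem_negOrthant_of_le hm hu
  rw [velocity, norm_neg]
  refine (pi_norm_le_iff_of_nonneg (Finset.sum_nonneg fun s _ => by positivity)).2 fun i => ?_
  rw [flux_apply, Real.norm_eq_abs]
  refine (Finset.abs_sum_le_sum_abs _ _).trans (Finset.sum_le_sum fun s _ => ?_)
  have b : |φ (Z.K u (Z.P s) - Z.K u (Z.Q s))| ≤ B :=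
    abs_le_of_monotone_of_abs_le hφ
      ((abs_sub _ _).trans (by linarith [hM u huU (Z.P s), hM u huU (Z.Q s)]))
  have hβ : |Z.β s u| ≤ |C| := by
    rw [abs_of_nonneg (Z.β_nonneg s u huU)]; exact (hC u hu s).1.trans (le_abs_self C)
  have hξ : |Z.ξ s u| ≤ |C| := by
    rw [abs_of_pos (Z.ξ_pos s u huU)]; exact (hC u hu s).2.trans (le_abs_self C)
  have hk : ∀ j, |Z.ξ s u * Z.K u j| ≤ |C| * |M| := fun j => by
    rw [abs_mul]
    exact mul_le_mul hξ ((hM u huU j).trans (le_abs_self M)) (abs_nonneg _) (abs_nonneg _)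
  have hB0 : 0 ≤ |C| * (|C| * |M| + B) := by positivity
  refine (abs_add_le _ _).trans (add_le_add ?_ ?_)
  · split_ifs
    · rw [abs_mul]
      exact mul_le_mul hβ ((abs_add_le _ _).trans (add_le_add (hk _) b)) (abs_nonneg _)
        (abs_nonneg _)
    · simpa using hB0
  · split_ifs
    · rw [abs_mul]
      exact mul_le_mul hβ ((abs_sub _ _).trans (add_le_add (hk _) b)) (abs_nonneg _)
        (abs_nonneg _)
    · simpa using hB0

/-- A solution of the flow on any finite time interval. The velocity field is first made bounded
by truncating its argument at the level `-m`; the solution of the modified equation does not cross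
this level, so that it solves the original equation. -/
theorem exists_solution_Icc (hφ : Monotone φ) (hφc : Continuous φ) {u₀ : V → ℝ}
    (hu₀ : u₀ ∈ negOrthant V) :
    ∃ m > 0, ∀ T ≥ 0, ∃ u : ℝ → V → ℝ, u 0 = u₀ ∧ ∀ t ∈ Set.Icc 0 T, (∀ i, u t i ≤ -m) ∧
      HasDerivWithinAt u (Z.velocity φ (u t)) (Set.Icc 0 T) t := by
  obtain ⟨m₀, hm₀, hbar⟩ := Z.exists_velocity_nonpos hφ
  obtain ⟨m₁, hm₁, hle⟩ := exists_pos_forall_le (isCompact_singleton (x := u₀))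
    (f := fun (i : V) u => -u i) (fun i => (continuous_apply i).neg.continuousOn)
    (fun i u hu => by rw [hu]; exact neg_pos.2 (hu₀ i))
  have hm : 0 < min m₀ m₁ := lt_min hm₀ hm₁
  refine ⟨min m₀ m₁, hm, fun T hT => ?_⟩
  set m := min m₀ m₁ with hmdef
  set τ : (V → ℝ) → V → ℝ := fun u i => min (u i) (-m) with hτ
  have hτc : Continuous τ := continuous_pi fun i => (continuous_apply i).min continuous_const
  have hτle : ∀ u i, τ u i ≤ -m := fun u i => min_le_right _ _
  have hτU : ∀ u, τ u ∈ negOrthant V := fun u => mem_negOrthant_of_le hm (hτle u)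
  obtain ⟨C, hC⟩ := Z.exists_velocity_le hφ hm
  obtain ⟨u, hu0, hu⟩ := exists_solution_of_continuous (X := fun u => Z.velocity φ (τ u))
    ((Z.continuousOn_velocity hφc).comp_continuous hτc hτU) (fun u => hC _ (hτle u)) u₀ hT
  have hum : ∀ t ∈ Set.Icc 0 T, ∀ i, u t i ≤ -m := by
    intro t ht i
    refine le_of_deriv_nonpos_above (f := fun t => u t i)
      (fun s hs => hasDerivWithinAt_pi.1 (hu s hs) i) ?_ (fun s hs h => ?_) ht
    · have := hle i u₀ rfl
      have h2 : m ≤ m₁ := min_le_right _ _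
      simp only [hu0]
      linarith
    · refine hbar _ (hτU _) i ?_
      have h2 : m ≤ m₀ := min_le_left _ _
      simp only [hτ]
      rw [min_eq_right h]
      linarith
  refine ⟨u, hu0, fun t ht => ⟨hum t ht, ?_⟩⟩
  have : τ (u t) = u t := funext fun i => min_eq_left (hum t ht i)
  have h := hu t ht
  simp only [this] at h
  exact h

/-- The flow exists for all times and stays away from the upper end of the orthant. -/
theorem exists_solution_Ici (hφ : Monotone φ) (hφc : Continuous φ) {u₀ : V → ℝ}
    (hu₀ : u₀ ∈ negOrthant V) :
    ∃ m > 0, ∃ u : ℝ → V → ℝ, u 0 = u₀ ∧ ∀ t ∈ Set.Ici (0 : ℝ), (∀ i, u t i ≤ -m) ∧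
      HasDerivWithinAt u (Z.velocity φ (u t)) (Set.Ici 0) t := by
  obtain ⟨m, hm, hsol⟩ := Z.exists_solution_Icc hφ hφc hu₀
  choose w hw0 hw using fun n : ℕ => hsol n n.cast_nonneg
  have huniq : ∀ k l : ℕ, k ≤ l → Set.EqOn (w k) (w l) (Set.Icc 0 (k : ℝ)) := by
    intro k l hkl
    have hsub : Set.Icc (0 : ℝ) k ⊆ Set.Icc 0 (l : ℝ) :=
      Set.Icc_subset_Icc_right (Nat.cast_le.2 hkl)
    exact Z.solution_unique hφ hφc (fun t ht => (hw k t ht).2)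
      (fun t ht => (hw l t (hsub ht)).2.mono hsub)
      (fun t ht => mem_negOrthant_of_le hm (hw k t ht).1)
      (fun t ht => mem_negOrthant_of_le hm (hw l t (hsub ht)).1) ((hw0 k).trans (hw0 l).symm)
  set u : ℝ → V → ℝ := fun t => w (⌈t⌉₊ + 1) t with hu
  have hueq : ∀ n : ℕ, Set.EqOn u (w n) (Set.Icc 0 (n : ℝ)) := by
    intro n t ht
    have ht' : t ≤ (⌈t⌉₊ + 1 : ℕ) := by push_cast; linarith [Nat.le_ceil t]
    rcases le_total n (⌈t⌉₊ + 1) with h | h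
    · exact (huniq _ _ h ht).symm
    · exact huniq _ _ h ⟨ht.1, ht'⟩
  refine ⟨m, hm, u, ?_, fun t ht => ?_⟩
  · rw [hueq 0 (by simp), hw0]
  · have ht0 : (0 : ℝ) ≤ t := ht
    set n := ⌈t⌉₊ + 1 with hn
    have htn : t < (n : ℝ) := by rw [hn]; push_cast; linarith [Nat.le_ceil t]
    have htI : t ∈ Set.Icc 0 (n : ℝ) := ⟨ht0, htn.le⟩
    have hnhds : Set.Icc 0 (n : ℝ) ∈ 𝓝[Set.Ici 0] t :=
      inter_mem self_mem_nhdsWithin (mem_nhdsWithin_of_mem_nhds (Iic_mem_nhds htn))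
    rw [hueq n htI]
    refine ⟨(hw n t htI).1, ?_⟩
    refine ((hw n t htI).2.mono_of_mem_nhdsWithin hnhds).congr_of_eventuallyEq ?_ (hueq n htI)
    filter_upwards [hnhds] with s hs using hueq n hs

theorem eq_zero_of_velocity_eq_zero (hφ : Monotone φ) (hφ0 : φ 0 = 0) {u : V → ℝ}
    (hu : u ∈ negOrthant V) (h : Z.velocity φ u = 0) : Z.K u = 0 := by
  obtain ⟨c, hc, hcoer⟩ := Z.exists_coercive (isCompact_singleton (x := u))
    (Set.singleton_subset_iff.2 hu)
  have h1 := hcoer φ hφ hφ0 u rfl (Z.K u)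
  rw [velocity, neg_eq_zero] at h
  rw [h, zero_dotProduct] at h1
  have h2 : Z.K u ⬝ᵥ Z.K u ≤ 0 := by
    by_contra! h3
    linarith [mul_pos hc h3]
  have h3 := norm_sq_le_dotProduct (Z.K u)
  have h4 : ‖Z.K u‖ = 0 := by nlinarith [sq_nonneg ‖Z.K u‖]
  exact norm_eq_zero.1 h4

/-- The limit of a solution has zero curvature. -/
theorem K_eq_zero_of_tendsto (hφ : Monotone φ) (hφc : Continuous φ) (hφ0 : φ 0 = 0)
    {u : ℝ → V → ℝ}
    (hu : ∀ t ∈ Set.Ici (0 : ℝ), HasDerivWithinAt u (Z.velocity φ (u t)) (Set.Ici 0) t)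
    {y : V → ℝ} (hy : y ∈ negOrthant V) (hlim : Tendsto u atTop (𝓝 y)) : Z.K y = 0 := by
  refine Z.eq_zero_of_velocity_eq_zero hφ hφ0 hy (eq_zero_of_tendsto_deriv hu hlim ?_)
  exact ((Z.continuousOn_velocity hφc).continuousAt
    ((isOpen_negOrthant V).mem_nhds hy)).tendsto.comp hlim

/-- `E` is a potential of the curvature: along every curve its derivative is the pairing of the
curvature with the velocity. -/
def IsPotential (E : (V → ℝ) → ℝ) : Prop :=
  ∀ (w : ℝ → V → ℝ) (w' : V → ℝ) (s : Set ℝ) (t : ℝ), w t ∈ negOrthant V →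
    HasDerivWithinAt w w' s t → HasDerivWithinAt (fun t => E (w t)) (Z.K (w t) ⬝ᵥ w') s t

/-- The derivative of the curvature is symmetric and the orthant is convex, so that the Poincaré
lemma applies. -/
theorem exists_potential : ∃ E, Z.IsPotential E := by
  set D : (V → ℝ) →L[ℝ] ((V → ℝ) →L[ℝ] ℝ) :=
    ∑ i, (ContinuousLinearMap.proj (R := ℝ) (φ := fun _ : V => ℝ) i).smulRight
      (ContinuousLinearMap.proj (R := ℝ) (φ := fun _ : V => ℝ) i) with hD
  have hDa : ∀ k z, D k z = k ⬝ᵥ z := by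
    intro k z
    simp [hD, dotProduct]
  have hω : ∀ u ∈ negOrthant V, HasFDerivAt (fun u => D (Z.K u)) (D.comp (Z.dK u)) u :=
    fun u hu => D.hasFDerivAt.comp u (Z.hasFDerivAt_K u hu)
  obtain ⟨E, hE⟩ := (convex_negOrthant V).exists_forall_hasFDerivAt_of_fderiv_symmetric
    (isOpen_negOrthant V) (ω := fun u => D (Z.K u))
    (fun u hu => (hω u hu).differentiableAt.differentiableWithinAt) (fun u hu x y => by
      rw [(hω u hu).fderiv]
      simp only [ContinuousLinearMap.comp_apply, hDa]
      exact fluxCLM_symm _ _)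
  refine ⟨E, fun w w' s t ht hw => ?_⟩
  have := (hE _ ht).comp_hasDerivWithinAt t hw
  rw [hDa] at this
  exact this

end CurvatureSystem

end CirclePacking

/-! ### Convergence to zero curvature -/

namespace CirclePacking
open Filter Topology

namespace CurvatureSystem

variable {V S : Type*} [Fintype V] [Fintype S] [DecidableEq V] (Z : CurvatureSystem V S)
variable {φ : ℝ → ℝ}

variable {Z} {E : (V → ℝ) → ℝ} {y : V → ℝ}

theorem monotoneOn_K_line (hy : y ∈ negOrthant V) {x : V → ℝ} (hx : x ∈ negOrthant V) :
    MonotoneOn (fun s : ℝ => Z.K (y + s • (x - y)) ⬝ᵥ (x - y)) (Set.Icc 0 1) := by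
  have hmem : ∀ s ∈ Set.Icc (0 : ℝ) 1, y + s • (x - y) ∈ negOrthant V :=
    fun s hs => (convex_negOrthant V).add_smul_sub_mem hy hx hs
  refine monotoneOn_of_hasDerivWithinAt_nonneg (convex_Icc 0 1)
    (fun s hs => (Z.hasDerivAt_K_line (hmem s hs)).continuousAt.continuousWithinAt)
    (fun s hs => (Z.hasDerivAt_K_line (hmem s (interior_subset hs))).hasDerivWithinAt)
    fun s hs => ?_
  have hm := hmem s (interior_subset hs)
  have h := flux_sub_dotProduct_nonneg (P := Z.P) (Q := Z.Q) (fun s => Z.β_nonneg s _ hm)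
    (fun s => (Z.ξ_pos s _ hm).le) monotone_id (x - y) 0
  rw [dotProduct_comm, ← fluxCLM_apply, ← fluxCLM_apply, map_zero, sub_zero, sub_zero] at h
  exact h

theorem IsPotential.hasDerivAt_line (hE : Z.IsPotential E) {x : V → ℝ} {s : ℝ}
    (hm : y + s • (x - y) ∈ negOrthant V) :
    HasDerivAt (fun s : ℝ => E (y + s • (x - y))) (Z.K (y + s • (x - y)) ⬝ᵥ (x - y)) s := by
  have h1 : HasDerivAt (fun s : ℝ => y + s • (x - y)) (x - y) s := by
    simpa only [one_smul, id] using ((hasDerivAt_id s).smul_const (x - y)).const_add y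
  exact (hE _ _ Set.univ s hm h1.hasDerivWithinAt).hasDerivAt univ_mem

/-- As the curvature is monotone along segments, the potential grows on `[a, b]` at least at the
rate that it has at `a`. -/
theorem IsPotential.mul_sub_le (hE : Z.IsPotential E) (hy : y ∈ negOrthant V) {x : V → ℝ}
    (hx : x ∈ negOrthant V) {a b κ : ℝ} (ha : 0 ≤ a) (hab : a ≤ b) (hb : b ≤ 1)
    (hκ : κ ≤ Z.K (y + a • (x - y)) ⬝ᵥ (x - y)) :
    κ * (b - a) ≤ E (y + b • (x - y)) - E (y + a • (x - y)) := by
  have hmem : ∀ s ∈ Set.Icc a b, y + s • (x - y) ∈ negOrthant V := fun s hs =>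
    (convex_negOrthant V).add_smul_sub_mem hy hx ⟨ha.trans hs.1, hs.2.trans hb⟩
  have hd := fun s hs => hE.hasDerivAt_line (x := x) (y := y) (s := s) (hmem s hs)
  refine (convex_Icc a b).mul_sub_le_image_sub_of_le_deriv
    (f := fun s : ℝ => E (y + s • (x - y)))
    (fun s hs => (hd s hs).continuousAt.continuousWithinAt)
    (fun s hs => (hd s (interior_subset hs)).differentiableAt.differentiableWithinAt)
    (fun s hs => ?_) a ⟨le_rfl, hab⟩ b ⟨hab, le_rfl⟩ hab
  have hs' := interior_subset hs
  rw [(hd s hs').deriv]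
  exact hκ.trans (monotoneOn_K_line hy hx ⟨ha, hab.trans hb⟩ ⟨ha.trans hs'.1, hs'.2.trans hb⟩ hs'.1)

/-- The gradient inequality for the convex potential. -/
theorem IsPotential.sub_le (hE : Z.IsPotential E) (hy : y ∈ negOrthant V) {x : V → ℝ}
    (hx : x ∈ negOrthant V) : E x - E y ≤ Z.K x ⬝ᵥ (x - y) := by
  have h := hE.mul_sub_le hx hy (a := 0) (b := 1) le_rfl zero_le_one le_rfl le_rfl
  simp only [zero_smul, add_zero, sub_zero, mul_one, one_smul, add_sub_cancel] at h
  rw [← neg_sub x y, dotProduct_neg] at h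
  linarith

/-- The potential increases at least linearly away from a zero of the curvature. -/
theorem IsPotential.exists_linear_growth (hE : Z.IsPotential E) (hy : y ∈ negOrthant V)
    (hKy : Z.K y = 0) {ε : ℝ} (hε : 0 < ε) :
    ∃ δ > 0, δ ≤ ε ∧ ∃ κ > 0, ∀ x ∈ negOrthant V, κ * (‖x - y‖ - δ) ≤ E x - E y := by
  obtain ⟨δ, hδ, hδε, hsub⟩ : ∃ δ > 0, δ ≤ ε ∧ Metric.closedBall y δ ⊆ negOrthant V := by
    obtain ⟨δ₀, hδ₀, hball⟩ := Metric.nhds_basis_closedBall.mem_iff.1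
      ((isOpen_negOrthant V).mem_nhds hy)
    exact ⟨min δ₀ ε, lt_min hδ₀ hε, min_le_right _ _,
      (Metric.closedBall_subset_closedBall (min_le_left _ _)).trans hball⟩
  obtain ⟨c, hc, hmono⟩ := Z.exists_strongly_monotone (isCompact_closedBall y δ)
    (convex_closedBall y δ) hsub
  have hyb : y ∈ Metric.closedBall y δ := Metric.mem_closedBall_self hδ.le
  refine ⟨δ, hδ, hδε, c * δ, mul_pos hc hδ, fun x hx => ?_⟩
  have hK0 : (0 : ℝ) ≤ Z.K (y + (0 : ℝ) • (x - y)) ⬝ᵥ (x - y) := by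
    rw [zero_smul, add_zero, hKy, zero_dotProduct]
  rcases le_or_gt ‖x - y‖ δ with h | h
  · have h1 := hE.mul_sub_le hy hx (a := 0) (b := 1) le_rfl zero_le_one le_rfl hK0
    simp only [zero_smul, add_zero, zero_mul, one_smul, add_sub_cancel] at h1
    exact (mul_nonpos_of_nonneg_of_nonpos (by positivity) (by linarith)).trans h1
  · -- the point `p` where the segment from `y` to `x` leaves the ball of radius `δ`
    have hw : 0 < ‖x - y‖ := hδ.trans h
    set a := δ / ‖x - y‖ with ha
    have ha0 : 0 < a := div_pos hδ hw
    have ha1 : a ≤ 1 := (div_le_one hw).2 h.le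
    have haw : a * ‖x - y‖ = δ := by rw [ha]; field_simp
    have hnorm : ‖a • (x - y)‖ = δ := by rw [norm_smul, Real.norm_of_nonneg ha0.le, haw]
    have h1 := hmono y hyb (y + a • (x - y)) (by
      rw [mem_closedBall_iff_norm, add_sub_cancel_left, hnorm])
    have hsmul : Z.K (y + a • (x - y)) ⬝ᵥ (a • (x - y)) =
        a * (Z.K (y + a • (x - y)) ⬝ᵥ (x - y)) := by rw [dotProduct_smul, smul_eq_mul]
    rw [hKy, sub_zero, add_sub_cancel_left, hsmul] at h1
    have h2 := norm_sq_le_dotProduct (a • (x - y))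
    rw [hnorm] at h2
    have h3 : c * δ * ‖x - y‖ ≤ Z.K (y + a • (x - y)) ⬝ᵥ (x - y) := by
      have h4 : c * δ ^ 2 ≤ c * (a • (x - y)) ⬝ᵥ (a • (x - y)) := by gcongr
      have h5 : a * (c * δ * ‖x - y‖) = c * δ ^ 2 := by
        rw [← haw]; ring
      have h6 := (h5.le.trans h4).trans h1
      exact le_of_mul_le_mul_left h6 ha0
    have h7 := hE.mul_sub_le hy hx (a := a) (b := 1) ha0.le ha1 le_rfl h3
    have h8 := hE.mul_sub_le hy hx (a := 0) (b := a) le_rfl ha0.le ha1 hK0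
    simp only [zero_smul, add_zero, zero_mul, one_smul, add_sub_cancel] at h7 h8
    have h9 : c * δ * ‖x - y‖ * (1 - a) = c * δ * (‖x - y‖ - δ) := by
      rw [← haw]; ring
    linarith

/-- A solution converges to any zero of the curvature. The potential is decreasing along the
solution, which therefore remains in a compact set; there the dissipation dominates the potential,
so that the latter decays exponentially. -/
theorem tendsto_of_K_eq_zero (Z : CurvatureSystem V S) (hφ : Monotone φ) (hφ0 : φ 0 = 0) {m : ℝ}
    (hm : 0 < m) {u : ℝ → V → ℝ}
    (hu : ∀ t ∈ Set.Ici (0 : ℝ), (∀ i, u t i ≤ -m) ∧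
      HasDerivWithinAt u (Z.velocity φ (u t)) (Set.Ici 0) t)
    (hy : y ∈ negOrthant V) (hKy : Z.K y = 0) : Tendsto u atTop (𝓝 y) := by
  obtain ⟨E, hE⟩ := Z.exists_potential
  have huU : ∀ t ∈ Set.Ici (0 : ℝ), u t ∈ negOrthant V :=
    fun t ht => mem_negOrthant_of_le hm (hu t ht).1
  set h : ℝ → ℝ := fun t => E (u t) - E y with hh
  set h' : ℝ → ℝ := fun t => Z.K (u t) ⬝ᵥ Z.velocity φ (u t) with hh'
  have hd : ∀ t ∈ Set.Ici (0 : ℝ), HasDerivWithinAt h (h' t) (Set.Ici 0) t := fun t ht =>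
    (hE _ _ _ _ (huU t ht) (hu t ht).2).sub_const _
  have hd' : ∀ T, ∀ t ∈ Set.Icc 0 T, HasDerivWithinAt h (h' t) (Set.Icc 0 T) t := fun T t ht =>
    (hd t ht.1).mono Set.Icc_subset_Ici_self
  have hvel : ∀ x, Z.K x ⬝ᵥ Z.velocity φ x =
      -(flux Z.P Z.Q (fun s => Z.β s x) (fun s => Z.ξ s x) φ (Z.K x) ⬝ᵥ Z.K x) := fun x => by
    rw [velocity, dotProduct_neg, dotProduct_comm]
  have hdec : ∀ t ∈ Set.Ici (0 : ℝ), h t ≤ h 0 := by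
    intro t ht
    have h1 := le_mul_exp_of_deriv_le (C := 0) (hd' t) (fun s hs => ?_) ⟨ht, le_rfl⟩
    · simpa using h1
    · have hs' := huU s hs.1
      have h2 := sum_vertexWeight_mul_sq_le (P := Z.P) (Q := Z.Q) (ξ := fun e => Z.ξ e (u s))
        (fun e => Z.β_nonneg e _ hs') hφ hφ0 (Z.K (u s))
      have h3 : 0 ≤ ∑ i, vertexWeight Z.P Z.Q (fun e => Z.β e (u s)) (fun e => Z.ξ e (u s)) i *
          Z.K (u s) i ^ 2 := Finset.sum_nonneg fun i _ =>
        mul_nonneg (Z.vertexWeight_pos hs' i).le (sq_nonneg _)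
      simp only [hh', hvel]
      linarith
  obtain ⟨δ, hδ, -, κ, hκ, hgrow⟩ := hE.exists_linear_growth hy hKy one_pos
  set R := h 0 / κ + δ with hR
  have huR : ∀ t ∈ Set.Ici (0 : ℝ), ‖u t - y‖ ≤ R := by
    intro t ht
    have h1 := (hgrow _ (huU t ht)).trans (hdec t ht)
    rw [mul_comm, ← le_div_iff₀ hκ] at h1
    linarith
  obtain ⟨Y, hY, hc, hYU, hWY⟩ := exists_compact_convex_superset
    (W := insert y (Metric.closedBall y R ∩ {x | ∀ i, x i ≤ -m}))
    (((isCompact_closedBall y R).inter_right (by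
      rw [Set.ofPred_forall]
      exact isClosed_iInter fun i => isClosed_le (continuous_apply i) continuous_const)).insert y)
    (by
      rintro x (rfl | hx)
      exacts [hy, mem_negOrthant_of_le hm hx.2])
  have huY : ∀ t ∈ Set.Ici (0 : ℝ), u t ∈ Y := fun t ht =>
    hWY (Or.inr ⟨mem_closedBall_iff_norm.2 (huR t ht), (hu t ht).1⟩)
  have hyY : y ∈ Y := hWY (Or.inl rfl)
  obtain ⟨c, hc0, hmono⟩ := Z.exists_strongly_monotone hY hc hYU
  obtain ⟨c', hc'0, hcoer⟩ := Z.exists_coercive hY hYU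
  set N : ℝ := (Fintype.card V : ℝ)
  have hN : 0 ≤ N := Nat.cast_nonneg _
  -- the potential is bounded by the square of the curvature
  have hbound : ∀ x ∈ Y, c * (E x - E y) ≤ (N ^ 2 + 1) * (Z.K x ⬝ᵥ Z.K x) := by
    intro x hx
    have h1 := hE.sub_le hy (hYU hx)
    have h2 := hmono y hyY x hx
    rw [hKy, sub_zero] at h2
    have h3 := norm_sq_le_dotProduct (x - y)
    have h4 := (le_abs_self _).trans (abs_dotProduct_le (Z.K x) (x - y))
    have h5 := norm_sq_le_dotProduct (Z.K x)
    have h6 : c * ‖x - y‖ ≤ N * ‖Z.K x‖ := by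
      rcases (norm_nonneg (x - y)).eq_or_lt with h0 | h0
      · rw [← h0, mul_zero]; positivity
      · have : c * ‖x - y‖ ^ 2 ≤ N * (‖Z.K x‖ * ‖x - y‖) :=
          ((mul_le_mul_of_nonneg_left h3 hc0.le).trans h2).trans h4
        refine le_of_mul_le_mul_right ?_ h0
        linarith
    calc c * (E x - E y) ≤ c * (N * (‖Z.K x‖ * ‖x - y‖)) :=
          mul_le_mul_of_nonneg_left (h1.trans h4) hc0.le
      _ = N * ‖Z.K x‖ * (c * ‖x - y‖) := by ring
      _ ≤ N * ‖Z.K x‖ * (N * ‖Z.K x‖) := by gcongr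
      _ = N ^ 2 * ‖Z.K x‖ ^ 2 := by ring
      _ ≤ (N ^ 2 + 1) * (Z.K x ⬝ᵥ Z.K x) := by
        gcongr
        linarith
  set lam := c' * c / (N ^ 2 + 1) with hlam
  have hlam0 : 0 < lam := by positivity
  have hexp : ∀ t ∈ Set.Ici (0 : ℝ), h t ≤ h 0 * Real.exp (-lam * t) := by
    intro t ht
    refine le_mul_exp_of_deriv_le (hd' t) (fun s hs => ?_) ⟨ht, le_rfl⟩
    have h1 := hcoer φ hφ hφ0 _ (huY s hs.1) (Z.K (u s))
    have h2 := mul_le_mul_of_nonneg_left (hbound _ (huY s hs.1)) hc'0.le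
    have h3 : lam * h s ≤ c' * (Z.K (u s) ⬝ᵥ Z.K (u s)) := by
      rw [hlam, div_mul_eq_mul_div, div_le_iff₀ (by positivity)]
      simp only [hh]
      linarith
    simp only [hh', hvel]
    linarith
  have hlim : Tendsto (fun t => h 0 * Real.exp (-lam * t)) atTop (𝓝 0) := by
    have : Tendsto (fun t : ℝ => -lam * t) atTop atBot :=
      tendsto_id.const_mul_atTop_of_neg (neg_lt_zero.2 hlam0)
    simpa using (Real.tendsto_exp_atBot.comp this).const_mul (h 0)
  rw [Metric.tendsto_atTop]
  intro ε hε
  obtain ⟨δ, hδ, hδε, κ, hκ, hgrow⟩ := hE.exists_linear_growth hy hKy (half_pos hε)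
  obtain ⟨t₀, ht₀⟩ := (hlim.eventually (gt_mem_nhds (mul_pos hκ hδ))).exists_forall_of_atTop
  refine ⟨max t₀ 0, fun t ht => ?_⟩
  have ht0 : t ∈ Set.Ici (0 : ℝ) := (le_max_right _ _).trans ht
  have h1 := (hgrow _ (huU t ht0)).trans_lt
    ((hexp t ht0).trans_lt (ht₀ t ((le_max_left _ _).trans ht)))
  have h2 := lt_of_mul_lt_mul_left h1 hκ.le
  rw [dist_eq_norm]
  linarith

end CurvatureSystem

end CirclePacking

/-! ### The logarithmic radius and the powers in the `p`-Laplacian -/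

namespace CirclePacking
open Filter Topology

/-- The radius of a circle as a function of the logarithmic coordinate `x = log (tanh (r / 2))`,
written in the equivalent form `sinh r = 1 / sinh (-x)`. -/
def radius (x : ℝ) : ℝ := Real.arsinh (Real.sinh (-x))⁻¹

/-- The logarithmic coordinate `log (tanh (r / 2))` of a radius; up to signs it is given by the same
formula as its inverse function. -/
def logCoord (r : ℝ) : ℝ := -radius (-r)

theorem sinh_radius (x : ℝ) : Real.sinh (radius x) = (Real.sinh (-x))⁻¹ := Real.sinh_arsinh _

theorem radius_pos {x : ℝ} (hx : x < 0) : 0 < radius x :=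
  Real.arsinh_pos_iff.2 (inv_pos.2 (Real.sinh_pos_iff.2 (neg_pos.2 hx)))

theorem logCoord_neg {r : ℝ} (hr : 0 < r) : logCoord r < 0 :=
  neg_lt_zero.2 (radius_pos (neg_lt_zero.2 hr))

theorem radius_logCoord (r : ℝ) : radius (logCoord r) = r := by
  rw [logCoord, radius, neg_neg, sinh_radius, inv_inv, neg_neg, Real.arsinh_sinh]

theorem logCoord_radius (x : ℝ) : logCoord (radius x) = x := by
  rw [logCoord, radius.eq_1 (-radius x), neg_neg, sinh_radius, inv_inv, Real.arsinh_sinh, neg_neg]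

theorem hasDerivAt_radius {x : ℝ} (hx : x < 0) :
    HasDerivAt radius (Real.sinh (radius x)) x := by
  have hs : 0 < Real.sinh (-x) := Real.sinh_pos_iff.2 (neg_pos.2 hx)
  have h := ((((hasDerivAt_id x).neg).sinh).fun_inv hs.ne').arsinh
  refine h.congr_deriv ?_
  have hsq : 1 + (Real.sinh (-x))⁻¹ ^ 2 = (Real.cosh (-x) / Real.sinh (-x)) ^ 2 := by
    rw [div_pow, Real.cosh_sq]
    field_simp
  have hc := Real.cosh_pos (-x)
  rw [sinh_radius]
  simp only [Pi.neg_apply, id, smul_eq_mul]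
  rw [hsq, Real.sqrt_sq (by positivity)]
  field_simp

/-- The defining property `du / dr = 1 / sinh r` of the logarithmic coordinate. -/
theorem hasDerivAt_logCoord {r : ℝ} (hr : 0 < r) :
    HasDerivAt logCoord (Real.sinh r)⁻¹ r := by
  have h := ((hasDerivAt_radius (neg_lt_zero.2 hr)).comp r (hasDerivAt_neg r)).neg
  refine h.congr_deriv ?_
  rw [sinh_radius, neg_neg]
  ring

theorem contDiffOn_radius : ContDiffOn ℝ 1 radius (Set.Iio 0) := by
  refine Real.contDiff_arsinh.comp_contDiffOn (ContDiffOn.inv ?_ fun x hx => ?_)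
  · exact (Real.contDiff_sinh.comp contDiff_neg).contDiffOn
  · exact (Real.sinh_pos_iff.2 (neg_pos.2 hx)).ne'

section signedPower

/-- The odd power function `x ↦ |x| ^ (p - 2) x`. -/
def signedPow (p x : ℝ) : ℝ := |x| ^ (p - 2) * x

/-- This form has only the exponent `p - 1 > 0`, and thus shows continuity and monotonicity also for
`p < 2`. -/
theorem signedPow_eq {p : ℝ} (hp : 1 < p) (x : ℝ) :
    signedPow p x = (max x 0) ^ (p - 1) - (max (-x) 0) ^ (p - 1) := by
  have h0 : (0 : ℝ) ^ (p - 1) = 0 := Real.zero_rpow (by linarith)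
  -- `0 ^ (p - 2)` may be a junk value, but in `signedPow` it is multiplied by `0`
  have hmul : ∀ y : ℝ, 0 < y → y ^ (p - 2) * y = y ^ (p - 1) := by
    intro y hy
    rw [← Real.rpow_add_one hy.ne']
    congr 1
    ring
  rw [signedPow]
  rcases lt_trichotomy x 0 with h | h | h
  · rw [max_eq_right h.le, max_eq_left (by linarith), h0, abs_of_neg h,
      ← hmul (-x) (by linarith)]
    ring
  · simp [h]
  · rw [max_eq_left h.le, max_eq_right (by linarith), h0, abs_of_pos h, hmul x h, sub_zero]

theorem monotone_signedPow {p : ℝ} (hp : 1 < p) : Monotone (signedPow p) := by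
  intro x y hxy
  rw [signedPow_eq hp, signedPow_eq hp]
  have h1 : (max x 0) ^ (p - 1) ≤ (max y 0) ^ (p - 1) :=
    Real.rpow_le_rpow (le_max_right _ _) (max_le_max_right _ hxy) (by linarith)
  have h2 : (max (-y) 0) ^ (p - 1) ≤ (max (-x) 0) ^ (p - 1) :=
    Real.rpow_le_rpow (le_max_right _ _) (max_le_max_right _ (neg_le_neg hxy)) (by linarith)
  linarith

theorem continuous_signedPow {p : ℝ} (hp : 1 < p) : Continuous (signedPow p) := by
  have : signedPow p = fun x => (max x 0) ^ (p - 1) - (max (-x) 0) ^ (p - 1) :=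
    funext (signedPow_eq hp)
  rw [this]
  have hp' : 0 ≤ p - 1 := by linarith
  exact ((continuous_id.max continuous_const).rpow_const fun _ => Or.inr hp').sub
    ((continuous_neg.max continuous_const).rpow_const fun _ => Or.inr hp')

theorem signedPow_zero (p : ℝ) : signedPow p 0 = 0 := by simp [signedPow]

theorem signedPow_neg (p x : ℝ) : signedPow p (-x) = -signedPow p x := by simp [signedPow]

end signedPower

section triangle

variable {φ : Fin 3 → ℝ}

theorem hasDerivAt_cornerAngle (hφ : ∀ a, 0 ≤ Real.cos (φ a)) {r : Fin 3 → ℝ → ℝ} {v : Fin 3 → ℝ}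
    {t : ℝ} (hr₀ : ∀ b, 0 < r b t) (hr : ∀ b, HasDerivAt (r b) (Real.sinh (r b t) * v b) t)
    (a : Fin 3) :
    HasDerivAt (fun t => cornerAngle φ (fun b => r b t) a)
      (sideCoeff φ (fun b => r b t) (a + 1) *
          (v (a + 2) - sideCosh φ (fun b => r b t) (a + 1) * v a) +
        sideCoeff φ (fun b => r b t) (a + 2) *
          (v (a + 1) - sideCosh φ (fun b => r b t) (a + 2) * v a)) t := by
  have h := (hasFDerivAt_cornerAngle hφ (v := fun b => ContinuousLinearMap.toSpanSingleton ℝ (v b))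
    hr₀ (fun b => ((hr b).hasFDerivAt).congr_fderiv (by ext; simp)) a).hasDerivAt
  refine h.congr_deriv ?_
  simp

/-- The derivative of the area, when the logarithmic radius coordinates have derivatives `v b`: in
the angle sum the mixed terms combine into the factor `cosh l - 1` of each side. -/
theorem hasDerivAt_triangleArea (hφ : ∀ a, 0 ≤ Real.cos (φ a)) {r : Fin 3 → ℝ → ℝ}
    {v : Fin 3 → ℝ} {t : ℝ} (hr₀ : ∀ b, 0 < r b t)
    (hr : ∀ b, HasDerivAt (r b) (Real.sinh (r b t) * v b) t) :
    HasDerivAt (fun t => triangleArea φ (fun b => r b t))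
      (∑ a, sideCoeff φ (fun b => r b t) a * (sideCosh φ (fun b => r b t) a - 1) *
        (v (a + 1) + v (a + 2))) t := by
  have h := (HasDerivAt.fun_sum (u := Finset.univ) fun a _ =>
    hasDerivAt_cornerAngle hφ hr₀ hr a).const_sub Real.pi
  refine h.congr_deriv ?_
  have e1 : (1 : Fin 3) + 1 = 2 := rfl
  have e2 : (1 : Fin 3) + 2 = 0 := rfl
  have e3 : (2 : Fin 3) + 1 = 0 := rfl
  have e4 : (2 : Fin 3) + 2 = 1 := rfl
  simp only [Fin.sum_univ_three, zero_add, e1, e2, e3, e4]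
  ring

/-- The derivative of the angle at one end of a side with respect to the radius at the other
end. -/
theorem deriv_cornerAngle_mul_sinh (hφ : ∀ a, 0 ≤ Real.cos (φ a)) {ρ : Fin 3 → ℝ}
    (hρ : ∀ b, 0 < ρ b) (a b c : Fin 3) (hbc : b = a + 1 ∧ c = a + 2 ∨ b = a + 2 ∧ c = a + 1) :
    deriv (fun x => cornerAngle φ (Function.update ρ c x) b) (ρ c) * Real.sinh (ρ c) =
      sideCoeff φ ρ a := by
  have hs : Real.sinh (ρ c) ≠ 0 := (Real.sinh_pos_iff.2 (hρ c)).ne'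
  have hupd : (fun d => Function.update ρ c (ρ c) d) = ρ := by simp
  have h := hasDerivAt_cornerAngle hφ (r := fun d x => Function.update ρ c x d)
    (v := fun d => if d = c then (Real.sinh (ρ c))⁻¹ else 0) (t := ρ c)
    (fun d => by simpa using hρ d)
    (fun d => by
      rcases eq_or_ne d c with rfl | hd
      · simpa [hs] using hasDerivAt_id' (ρ d)
      · simpa [hd] using hasDerivAt_const (ρ c) (ρ d)) b
  rw [hupd] at h
  rw [h.deriv]
  have n1 : a + 1 ≠ a + 2 := by clear hbc; revert a; decide
  have n2 : a ≠ a + 2 := by clear hbc; revert a; decide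
  have n3 : a ≠ a + 1 := by clear hbc; revert a; decide
  rcases hbc with ⟨rfl, rfl⟩ | ⟨rfl, rfl⟩
  · simp only [fin3_add_one_add_one, fin3_add_one_add_two, n1, n2, if_true, if_false]
    field_simp
    ring
  · simp only [fin3_add_two_add_one, fin3_add_two_add_two, n1.symm, n3, if_true, if_false]
    field_simp
    ring

variable {G : Type*} [NormedAddCommGroup G] [NormedSpace ℝ G]

theorem contDiffOn_sideCosh {ρ : Fin 3 → G → ℝ} {X : Set G}
    (hρ : ∀ b, ContDiffOn ℝ 1 (ρ b) X) (a : Fin 3) :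
    ContDiffOn ℝ 1 (fun u => sideCosh φ (fun b => ρ b u) a) X := by
  have hc : ∀ b, ContDiffOn ℝ 1 (fun u => Real.cosh (ρ b u)) X :=
    fun b => Real.contDiff_cosh.comp_contDiffOn (hρ b)
  have hs : ∀ b, ContDiffOn ℝ 1 (fun u => Real.sinh (ρ b u)) X :=
    fun b => Real.contDiff_sinh.comp_contDiffOn (hρ b)
  exact ((hc _).mul (hc _)).add (((hs _).mul (hs _)).mul contDiffOn_const)

theorem contDiffOn_sideCoeff (hφ : ∀ a, 0 ≤ Real.cos (φ a)) {ρ : Fin 3 → G → ℝ} {X : Set G}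
    (hρ : ∀ b, ContDiffOn ℝ 1 (ρ b) X) (hρ₀ : ∀ b, ∀ u ∈ X, 0 < ρ b u) (a : Fin 3) :
    ContDiffOn ℝ 1 (fun u => sideCoeff φ (fun b => ρ b u) a) X := by
  have hc : ∀ b, ContDiffOn ℝ 1 (fun u => Real.cosh (ρ b u)) X :=
    fun b => Real.contDiff_cosh.comp_contDiffOn (hρ b)
  have hx := fun b => contDiffOn_sideCosh (φ := φ) hρ b
  have hnum := (((hc a).mul (contDiffOn_const (c := (1 : ℝ)) |>.sub ((hx a).pow 2))).add
    ((hc (a + 1)).mul (((hx (a + 1)).mul (hx a)).sub (hx (a + 2))))).add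
    ((hc (a + 2)).mul (((hx (a + 2)).mul (hx a)).sub (hx (a + 1))))
  have hgram : ContDiffOn ℝ 1 (fun u => gramDet (sideCosh φ (fun b => ρ b u) a)
      (sideCosh φ (fun b => ρ b u) (a + 1)) (sideCosh φ (fun b => ρ b u) (a + 2))) X :=
    ((((contDiffOn_const (c := (1 : ℝ))).add (((contDiffOn_const (c := (2 : ℝ))).mul (hx a)).mul
      (hx (a + 1)) |>.mul (hx (a + 2)))).sub ((hx a).pow 2)).sub ((hx (a + 1)).pow 2)).sub
      ((hx (a + 2)).pow 2)
  have hpos : ∀ u ∈ X, 0 < gramDet (sideCosh φ (fun b => ρ b u) a)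
      (sideCosh φ (fun b => ρ b u) (a + 1)) (sideCosh φ (fun b => ρ b u) (a + 2)) :=
    fun u hu => gramDet_pos (fun b => hρ₀ b u hu) hφ a
  refine hnum.div ((((hx a).pow 2).sub (contDiffOn_const (c := (1 : ℝ)))).mul
    (hgram.sqrt fun u hu => (hpos u hu).ne')) fun u hu => ?_
  have h1 := one_lt_sideCosh (fun b => hρ₀ b u hu) hφ a
  exact mul_ne_zero (by nlinarith) (Real.sqrt_pos.2 (hpos u hu)).ne'

end triangle

end CirclePacking

/-! ### The curvature system of a weighted triangulation -/

namespace CirclePacking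
open Filter Topology

namespace Triangulation

variable {V E F : Type*} [Fintype V] [Fintype E] [Fintype F] [DecidableEq V] [DecidableEq E]
variable (T : Triangulation V E F) (Φ : E → ℝ)

/-- The first end point of a side of a triangle. -/
def sideP (s : F × Fin 3) : V := T.vert s.1 (s.2 + 1)

/-- The second end point of a side of a triangle. -/
def sideQ (s : F × Fin 3) : V := T.vert s.1 (s.2 + 2)

/-- The derivative of the angle of the triangle at one end of a side with respect to the logarithmic
radius at the other end. -/
def sideWeight (s : F × Fin 3) (r : V → ℝ) : ℝ :=
  sideCoeff (fun b => Φ (T.edge s.1 b)) (fun b => r (T.vert s.1 b)) s.2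

/-- `cosh l - 1` for the length `l` of a side. -/
def sideRatio (s : F × Fin 3) (r : V → ℝ) : ℝ :=
  sideCosh (fun b => Φ (T.edge s.1 b)) (fun b => r (T.vert s.1 b)) s.2 - 1

variable {T Φ}

theorem cornerAngle_nonneg (φ ρ : Fin 3 → ℝ) (a : Fin 3) : 0 ≤ cornerAngle φ ρ a :=
  Real.arccos_nonneg _

theorem cornerAngle_le_pi (φ ρ : Fin 3 → ℝ) (a : Fin 3) : cornerAngle φ ρ a ≤ Real.pi :=
  Real.arccos_le_pi _

omit [Fintype V] [Fintype E] in
theorem abs_curvature_le (r : V → ℝ) (i : V) :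
    |T.curvature Φ r i| ≤ 2 * Real.pi + Fintype.card (F × Fin 3) * Real.pi := by
  have h1 : ∑ c : F × Fin 3 with T.vert c.1 c.2 = i,
      cornerAngle (fun b => Φ (T.edge c.1 b)) (fun b => r (T.vert c.1 b)) c.2 ≤
      Fintype.card (F × Fin 3) * Real.pi := by
    refine (Finset.sum_le_card_nsmul _ _ Real.pi fun c _ => cornerAngle_le_pi _ _ _).trans ?_
    rw [nsmul_eq_mul]
    have := Real.pi_pos
    gcongr
    exact Finset.card_le_univ _
  have h2 : 0 ≤ ∑ c : F × Fin 3 with T.vert c.1 c.2 = i,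
      cornerAngle (fun b => Φ (T.edge c.1 b)) (fun b => r (T.vert c.1 b)) c.2 :=
    Finset.sum_nonneg fun c _ => cornerAngle_nonneg _ _ _
  rw [curvature, abs_le]
  constructor <;> linarith [Real.pi_pos]

omit [Fintype V] [Fintype E] in
/-- The differential of the curvature, when the logarithmic radius coordinates have differentials
`v i`: every corner at `i` contributes with the two sides ending there. -/
theorem hasFDerivAt_curvature {G : Type*} [NormedAddCommGroup G] [NormedSpace ℝ G]
    (hΦ : ∀ e, 0 ≤ Real.cos (Φ e)) {r : V → G → ℝ} {v : V → G →L[ℝ] ℝ} {e : G}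
    (hr₀ : ∀ i, 0 < r i e) (hr : ∀ i, HasFDerivAt (r i) (Real.sinh (r i e) • v i) e) (i : V) :
    HasFDerivAt (fun t => T.curvature Φ (fun j => r j t) i)
      (∑ s : F × Fin 3, T.sideWeight Φ s (fun j => r j e) •
        ((if T.sideP s = i then (T.sideRatio Φ s (fun j => r j e) + 1) • v (T.sideP s) -
            v (T.sideQ s) else 0) +
          if T.sideQ s = i then (T.sideRatio Φ s (fun j => r j e) + 1) • v (T.sideQ s) -
            v (T.sideP s) else 0)) e := by
  have h := (HasFDerivAt.fun_sum
    (u := Finset.univ.filter fun c : F × Fin 3 => T.vert c.1 c.2 = i) fun c _ =>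
    hasFDerivAt_cornerAngle (φ := fun b => Φ (T.edge c.1 b)) (fun a => hΦ _)
      (r := fun b => r (T.vert c.1 b)) (v := fun b => v (T.vert c.1 b)) (fun b => hr₀ _)
      (fun b => hr _) c.2).const_sub (2 * Real.pi)
  refine h.congr_fderiv ?_
  have e1 : (1 : Fin 3) + 1 = 2 := rfl
  have e2 : (1 : Fin 3) + 2 = 0 := rfl
  have e3 : (2 : Fin 3) + 1 = 0 := rfl
  have e4 : (2 : Fin 3) + 2 = 1 := rfl
  rw [Finset.sum_filter, Fintype.sum_prod_type, Fintype.sum_prod_type, ← Finset.sum_neg_distrib]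
  refine Finset.sum_congr rfl fun f _ => ?_
  simp only [Fin.sum_univ_three, sideP, sideQ, sideWeight, sideRatio, sub_add_cancel, zero_add,
    e1, e2, e3, e4]
  ext w
  split_ifs <;>
    simp only [add_apply, sub_apply, neg_apply, zero_apply, smul_apply, smul_eq_mul] <;> ring

theorem contDiffOn_radius_apply {V : Type*} [Fintype V] (j : V) :
    ContDiffOn ℝ 1 (fun u : V → ℝ => radius (u j)) (negOrthant V) :=
  contDiffOn_radius.comp (contDiff_apply ℝ ℝ j).contDiffOn fun _ hu => hu j

omit [Fintype V] [Fintype E] in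
/-- If the radius of a circle is large, then the angles at its centre are small, so that its
curvature is close to `2π`, and the sides ending there are long. -/
theorem exists_barrier (hΦ : ∀ e, 0 ≤ Real.cos (Φ e)) (M : ℝ) :
    ∃ m > 0, ∀ u ∈ negOrthant V, ∀ i, -m ≤ u i →
      1 ≤ T.curvature Φ (fun j => radius (u j)) i ∧
        ∀ s, T.sideP s = i ∨ T.sideQ s = i → M ≤ T.sideRatio Φ s (fun j => radius (u j)) := by
  set n : ℝ := (Fintype.card (F × Fin 3) : ℝ) with hn
  have hn0 : 0 ≤ n := Nat.cast_nonneg _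
  -- an angle that, taken at all corners, adds up to at most `1 < 2π - 1`
  set δ : ℝ := 1 / (n + 1) with hδ
  have hδ0 : 0 < δ := by positivity
  have hδ1 : δ ≤ 1 := by rw [hδ, div_le_one (by positivity)]; linarith
  have hnδ : n * δ ≤ 1 := by rw [hδ, mul_one_div, div_le_one (by positivity)]; linarith
  have hpi := Real.pi_gt_three
  have hcos : Real.cos δ < 1 := by
    rw [← Real.cos_zero]
    exact Real.cos_lt_cos_of_nonneg_of_le_pi le_rfl (by linarith) hδ0
  have hev : ∀ᶠ m in 𝓝[>] (0 : ℝ), 0 < m ∧ 2 * Real.sinh m ^ 2 < 1 - Real.cos δ ∧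
      (M + 1) * Real.sinh m < 1 := by
    refine Eventually.and self_mem_nhdsWithin (Eventually.filter_mono nhdsWithin_le_nhds
      (Eventually.and ?_ ?_))
    · have hc : ContinuousAt (fun m => 2 * Real.sinh m ^ 2) 0 :=
        (continuous_const.mul (Real.continuous_sinh.pow 2)).continuousAt
      exact hc.eventually (gt_mem_nhds (by simpa using hcos))
    · have hc : ContinuousAt (fun m => (M + 1) * Real.sinh m) 0 :=
        (continuous_const.mul Real.continuous_sinh).continuousAt
      exact hc.eventually (gt_mem_nhds (by simp))
  obtain ⟨m, hm, hm1, hm2⟩ := hev.exists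
  refine ⟨m, hm, fun u hu i hi => ?_⟩
  have hs : 0 < Real.sinh (-u i) := Real.sinh_pos_iff.2 (neg_pos.2 (hu i))
  have hsm : Real.sinh (-u i) ≤ Real.sinh m := Real.sinh_le_sinh.2 (by linarith)
  constructor
  · have hang : ∀ c ∈ Finset.univ.filter fun c : F × Fin 3 => T.vert c.1 c.2 = i,
        cornerAngle (fun b => Φ (T.edge c.1 b)) (fun b => radius (u (T.vert c.1 b))) c.2 ≤ δ := by
      intro c hc
      refine cornerAngle_le (fun b => radius_pos (hu _)) (fun b => hΦ _) _ hδ0.le (by linarith) ?_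
      rw [(Finset.mem_filter.1 hc).2, sinh_radius, inv_pow, div_inv_eq_mul]
      have : Real.sinh (-u i) ^ 2 ≤ Real.sinh m ^ 2 := pow_le_pow_left₀ hs.le hsm 2
      linarith
    have h1 := Finset.sum_le_card_nsmul _ _ _ hang
    rw [nsmul_eq_mul] at h1
    have h2 : ((Finset.univ.filter fun c : F × Fin 3 => T.vert c.1 c.2 = i).card : ℝ) ≤ n := by
      rw [hn]; exact_mod_cast Finset.card_le_univ _
    have h3 := mul_le_mul_of_nonneg_right h2 hδ0.le
    rw [curvature]
    linarith
  · intro s hsi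
    have h1 := sideCosh_ge (φ := fun b => Φ (T.edge s.1 b))
      (ρ := fun b => radius (u (T.vert s.1 b))) (fun b => radius_pos (hu _)) (fun b => hΦ _) s.2
    have h2 : M + 1 ≤ Real.sinh (radius (u i)) := by
      rw [sinh_radius, ← one_div, le_div_iff₀ hs]
      rcases le_or_gt 0 (M + 1) with h | h
      · exact (mul_le_mul_of_nonneg_left hsm h).trans hm2.le
      · nlinarith
    have h3 := (Real.sinh_lt_cosh (radius (u i))).le
    have h4 := Real.one_le_cosh (radius (u (T.vert s.1 (s.2 + 1))))
    have h5 := Real.one_le_cosh (radius (u (T.vert s.1 (s.2 + 2))))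
    rw [sideRatio]
    rcases hsi with h | h
    · rw [sideP] at h
      rw [h] at h1 h4
      nlinarith
    · rw [sideQ] at h
      rw [h] at h1 h5
      nlinarith

/-- The curvature of circle packing metrics in logarithmic radius coordinates; the edges of the
underlying graph are the sides of the triangles. -/
def curvatureSystem (T : Triangulation V E F) (Φ : E → ℝ) (hΦ : ∀ e, 0 ≤ Real.cos (Φ e)) :
    CurvatureSystem V (F × Fin 3) where
  P := T.sideP
  Q := T.sideQ
  β s u := T.sideWeight Φ s (fun j => radius (u j))
  ξ s u := T.sideRatio Φ s (fun j => radius (u j))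
  K u := T.curvature Φ (fun j => radius (u j))
  contDiffOn_β s := contDiffOn_sideCoeff (X := negOrthant V) (fun b => hΦ _)
    (fun b => contDiffOn_radius_apply (T.vert s.1 b)) (fun b u hu => radius_pos (hu _)) s.2
  contDiffOn_ξ s := (contDiffOn_sideCosh
    (fun b => contDiffOn_radius_apply (T.vert s.1 b)) s.2).sub contDiffOn_const
  β_nonneg s u hu := sideCoeff_nonneg (fun b => radius_pos (hu _)) (fun b => hΦ _) _
  ξ_pos s u hu := sub_pos.2 (one_lt_sideCosh (fun b => radius_pos (hu _)) (fun b => hΦ _) _)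
  exists_β_pos u hu i := by
    obtain ⟨f, a, rfl⟩ := T.vert_surj i
    rcases sideCoeff_pos_or (φ := fun b => Φ (T.edge f b))
      (ρ := fun b => radius (u (T.vert f b))) (fun b => radius_pos (hu _)) (fun b => hΦ _) a with
      h | h
    · exact ⟨(f, a + 1), Or.inr (by rw [sideQ, fin3_add_one_add_two]), h⟩
    · exact ⟨(f, a + 2), Or.inl (by rw [sideP, fin3_add_two_add_one]), h⟩
  hasFDerivAt_K u hu := by
    refine hasFDerivAt_pi'.2 fun i => ?_
    have hr : ∀ j, HasFDerivAt (fun u : V → ℝ => radius (u j)) (Real.sinh (radius (u j)) •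
        ContinuousLinearMap.proj (R := ℝ) (φ := fun _ : V => ℝ) j) u := fun j =>
      HasDerivAt.comp_hasFDerivAt (h₂ := radius) (f := fun u : V → ℝ => u j) u
        (hasDerivAt_radius (hu j))
        (ContinuousLinearMap.proj (R := ℝ) (φ := fun _ : V => ℝ) j).hasFDerivAt
    refine (hasFDerivAt_curvature hΦ (r := fun j (u : V → ℝ) => radius (u j))
      (fun j => radius_pos (hu j)) hr i).congr_fderiv ?_
    ext w
    rw [ContinuousLinearMap.comp_apply, ContinuousLinearMap.proj_apply, fluxCLM_apply, flux_apply,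
      sum_apply]
    refine Finset.sum_congr rfl fun s _ => ?_
    split_ifs <;>
      simp only [smul_apply, add_apply, sub_apply, zero_apply, ContinuousLinearMap.proj_apply,
        smul_eq_mul, id] <;> ring_nf
  exists_K_le := ⟨_, fun u _ i => abs_curvature_le _ i⟩
  exists_barrier := exists_barrier hΦ
  exists_coeff_le m hm := by
    refine ⟨max (5 * (1 + (Real.sinh m)⁻¹))
      (2 * ((1 + (Real.sinh m)⁻¹) * (1 + (Real.sinh m)⁻¹))), fun u hu s => ?_⟩
    have hu' : ∀ i, u i < 0 := fun i => (hu i).trans_lt (neg_lt_zero.2 hm)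
    have hcosh : ∀ i, Real.cosh (radius (u i)) ≤ 1 + (Real.sinh m)⁻¹ := by
      intro i
      have h1 : Real.sinh (radius (u i)) ≤ (Real.sinh m)⁻¹ := by
        rw [sinh_radius]
        exact inv_anti₀ (Real.sinh_pos_iff.2 hm) (Real.sinh_le_sinh.2 (by linarith [hu i]))
      have h2 := Real.cosh_sq (radius (u i))
      have h3 := Real.sinh_pos_iff.2 (radius_pos (hu' i))
      nlinarith [Real.cosh_pos (radius (u i))]
    constructor
    · exact (sideCoeff_le (fun b => radius_pos (hu' _)) (fun b => hΦ _) _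
        (fun b => hcosh _)).trans (le_max_left _ _)
    · have h1 := sideCosh_le (φ := fun b => Φ (T.edge s.1 b))
        (ρ := fun b => radius (u (T.vert s.1 b))) (fun b => radius_pos (hu' _)) s.2
      have h2 := mul_le_mul (hcosh (T.vert s.1 (s.2 + 1))) (hcosh (T.vert s.1 (s.2 + 2)))
        (Real.cosh_pos _).le ((Real.cosh_pos _).le.trans (hcosh (T.vert s.1 (s.2 + 1))))
      refine le_trans ?_ (le_max_right _ _)
      rw [sideRatio]
      linarith

end Triangulation

end CirclePacking

/-! ### The Calabi flow in logarithmic coordinates -/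

namespace CirclePacking
open Filter Topology

namespace Triangulation

variable {V E F : Type*} [Fintype V] [Fintype E] [Fintype F] [DecidableEq V] [DecidableEq E]
variable {T : Triangulation V E F} {Φ : E → ℝ}

omit [Fintype V] [Fintype E] [DecidableEq V] in
theorem vert_corner (f : F) (a : Fin 3) (ε : Bool) :
    T.vert f (T.corner f a ε) = T.ends (T.edge f a) ε := by
  rw [corner]
  split_ifs with h
  · rw [← h, T.vert_succ]
  · rw [T.vert_succ_succ, Bool.not_eq.2 h]

omit [Fintype V] [Fintype E] [DecidableEq V] in
theorem corner_eq_or (f : F) (a : Fin 3) (ε : Bool) :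
    T.corner f a ε = a + 1 ∧ T.corner f a (!ε) = a + 2 ∨
      T.corner f a ε = a + 2 ∧ T.corner f a (!ε) = a + 1 := by
  rw [corner, corner]
  cases T.side f a <;> cases ε <;> simp

omit [Fintype V] [Fintype E] [DecidableEq V] in
/-- The coefficient `B` of an edge does not depend on the choice of its end: it is the sum of the
weights of its two sides. -/
theorem edgeCoeff_eq (hΦ : ∀ e, 0 ≤ Real.cos (Φ e)) {r : V → ℝ} (hr : ∀ i, 0 < r i)
    (e : E) (ε : Bool) :
    T.edgeCoeff Φ r e ε = ∑ s : F × Fin 3 with T.edge s.1 s.2 = e, T.sideWeight Φ s r := by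
  refine Finset.sum_congr rfl fun s hs => ?_
  obtain rfl := (Finset.mem_filter.1 hs).2
  rw [← vert_corner]
  exact deriv_cornerAngle_mul_sinh (fun _ => hΦ _) (ρ := fun b => r (T.vert s.1 b))
    (fun _ => hr _) s.2 _ _ (corner_eq_or s.1 s.2 ε)

omit [Fintype V] [Fintype E] in
/-- The coefficient `A` is the potential part of the graph operator. -/
theorem areaCoeff_eq (hΦ : ∀ e, 0 ≤ Real.cos (Φ e)) {r : V → ℝ} (hr : ∀ i, 0 < r i) (i : V) :
    T.areaCoeff Φ r i = ∑ s : F × Fin 3, T.sideWeight Φ s r * T.sideRatio Φ s r *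
      ((if T.sideP s = i then 1 else 0) + if T.sideQ s = i then 1 else 0) := by
  have hs : Real.sinh (r i) ≠ 0 := (Real.sinh_pos_iff.2 (hr i)).ne'
  have hupd : ∀ j, Function.update r i (r i) j = r j := fun j => by simp
  -- if only `r i` varies, then its logarithmic coordinate has derivative `1 / sinh (r i)`
  have h := HasDerivAt.fun_sum (u := (Finset.univ : Finset F)) fun f _ =>
    hasDerivAt_triangleArea (φ := fun b => Φ (T.edge f b)) (fun _ => hΦ _)
      (r := fun b x => Function.update r i x (T.vert f b))
      (v := fun b => if T.vert f b = i then (Real.sinh (r i))⁻¹ else 0) (t := r i)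
      (fun b => by rw [hupd]; exact hr _)
      (fun b => by
        rw [hupd]
        rcases eq_or_ne (T.vert f b) i with hb | hb
        · simpa [hs, hb] using hasDerivAt_id' (r i)
        · simpa [hb] using hasDerivAt_const (r i) (r (T.vert f b)))
  rw [areaCoeff, h.deriv, Fintype.sum_prod_type, Finset.mul_sum]
  refine Finset.sum_congr rfl fun f _ => ?_
  rw [Finset.mul_sum]
  refine Finset.sum_congr rfl fun a _ => ?_
  simp only [hupd, sideP, sideQ, sideWeight, sideRatio]
  by_cases h1 : T.vert f (a + 1) = i <;> by_cases h2 : T.vert f (a + 2) = i <;>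
    simp only [h1, h2, if_true, if_false] <;> field_simp <;> ring

omit [Fintype V] in
/-- The `p`-Laplacian, summed over the sides of the triangles instead of the ends of the edges. -/
theorem pLaplacian_eq (hΦ : ∀ e, 0 ≤ Real.cos (Φ e)) {r : V → ℝ} (hr : ∀ i, 0 < r i)
    (p : ℝ) (g : V → ℝ) (i : V) :
    T.pLaplacian Φ p r g i = -∑ s : F × Fin 3, T.sideWeight Φ s r *
      ((if T.sideP s = i then signedPow p (g (T.sideP s) - g (T.sideQ s)) else 0) -
        if T.sideQ s = i then signedPow p (g (T.sideP s) - g (T.sideQ s)) else 0) := by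
  have h : T.pLaplacian Φ p r g i = ∑ ε : Bool, ∑ s : F × Fin 3,
      if T.ends (T.edge s.1 s.2) ε = i then T.sideWeight Φ s r *
        signedPow p (g (T.ends (T.edge s.1 s.2) !ε) - g i) else 0 := by
    rw [pLaplacian, Finset.sum_filter, Fintype.sum_prod_type_right]
    refine Finset.sum_congr rfl fun ε _ => ?_
    rw [← Finset.sum_fiberwise (Finset.univ : Finset (F × Fin 3)) (fun s => T.edge s.1 s.2)]
    refine Finset.sum_congr rfl fun e _ => ?_
    simp only [edgeCoeff_eq hΦ hr]
    split_ifs with he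
    · rw [mul_assoc, Finset.sum_mul]
      refine Finset.sum_congr rfl fun s hs => ?_
      rw [(Finset.mem_filter.1 hs).2, if_pos he, signedPow]
    · refine (Finset.sum_eq_zero fun s hs => ?_).symm
      rw [(Finset.mem_filter.1 hs).2, if_neg he]
  rw [h, Finset.sum_comm, ← Finset.sum_neg_distrib]
  refine Finset.sum_congr rfl fun s _ => ?_
  have hP : T.sideP s = T.ends (T.edge s.1 s.2) (T.side s.1 s.2) := T.vert_succ _ _
  have hQ : T.sideQ s = T.ends (T.edge s.1 s.2) (!T.side s.1 s.2) := T.vert_succ_succ _ _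
  have hsum : ∀ c : Bool → ℝ, ∑ ε, c ε = c (T.side s.1 s.2) + c (!T.side s.1 s.2) := by
    intro c
    cases T.side s.1 s.2 <;> simp [add_comm]
  rw [hsum, Bool.not_not, ← hP, ← hQ]
  have hneg := signedPow_neg p (g (T.sideP s) - g (T.sideQ s))
  rw [neg_sub] at hneg
  split_ifs with h1 h2 h2
  · rw [← h1, hneg, h1, ← h2, sub_self]; ring
  · rw [← h1, hneg]; ring
  · rw [← h2]; ring
  · ring

/-- The velocity of the flow in logarithmic radius coordinates. -/
theorem velocity_curvatureSystem (hΦ : ∀ e, 0 ≤ Real.cos (Φ e)) {u : V → ℝ}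
    (hu : u ∈ negOrthant V) (p : ℝ) (i : V) :
    (T.curvatureSystem Φ hΦ).velocity (signedPow p) u i =
      T.pLaplacian Φ p (fun j => radius (u j)) (T.curvature Φ fun j => radius (u j)) i -
        T.areaCoeff Φ (fun j => radius (u j)) i * T.curvature Φ (fun j => radius (u j)) i := by
  have hr : ∀ j, 0 < radius (u j) := fun j => radius_pos (hu j)
  rw [pLaplacian_eq hΦ hr, areaCoeff_eq hΦ hr, CurvatureSystem.velocity, Pi.neg_apply, flux_apply,
    ← sub_eq_zero, Finset.sum_mul, ← Finset.sum_neg_distrib, ← Finset.sum_neg_distrib,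
    ← Finset.sum_sub_distrib, ← Finset.sum_sub_distrib]
  refine Finset.sum_eq_zero fun s _ => ?_
  change -((if T.sideP s = i then _ else (0 : ℝ)) + if T.sideQ s = i then _ else (0 : ℝ)) - _ = _
  simp only [curvatureSystem]
  by_cases h1 : T.sideP s = i <;> by_cases h2 : T.sideQ s = i <;>
    simp only [h1, h2, if_true, if_false] <;> ring

/-- In logarithmic radius coordinates a Calabi flow is an integral curve of the velocity field of
the curvature system. -/
theorem IsCalabiFlow.hasDerivWithinAt_logCoord {p : ℝ} {X : Set ℝ} {q : ℝ → V → ℝ}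
    (hq : T.IsCalabiFlow Φ p X q) (hΦ : ∀ e, 0 ≤ Real.cos (Φ e)) {t : ℝ} (ht : t ∈ X) :
    HasDerivWithinAt (fun t i => logCoord (q t i))
      ((T.curvatureSystem Φ hΦ).velocity (signedPow p) fun i => logCoord (q t i)) X t := by
  refine hasDerivWithinAt_pi.2 fun i => ?_
  obtain ⟨hpos, hder⟩ := hq t ht i
  refine ((hasDerivAt_logCoord hpos).comp_hasDerivWithinAt t hder).congr_deriv ?_
  rw [velocity_curvatureSystem hΦ fun j => logCoord_neg (hq t ht j).1]
  simp only [radius_logCoord]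
  have := (Real.sinh_pos_iff.2 hpos).ne'
  field_simp

theorem isCalabiFlow_radius (hΦ : ∀ e, 0 ≤ Real.cos (Φ e)) {p : ℝ} {X : Set ℝ} {u : ℝ → V → ℝ}
    (huX : ∀ t ∈ X, u t ∈ negOrthant V)
    (hu : ∀ t ∈ X, HasDerivWithinAt u ((T.curvatureSystem Φ hΦ).velocity (signedPow p) (u t)) X t) :
    T.IsCalabiFlow Φ p X fun t i => radius (u t i) := by
  refine fun t ht i => ⟨radius_pos (huX t ht i), ?_⟩
  have h := (hasDerivAt_radius (huX t ht i)).comp_hasDerivWithinAt t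
    (hasDerivWithinAt_pi.1 (hu t ht) i)
  refine h.congr_deriv ?_
  rw [velocity_curvatureSystem hΦ (huX t ht), mul_comm]

end Triangulation

end CirclePacking

end

theorem mainTheorem2 {V E F : Type*} [Fintype V] [Fintype E] [Fintype F]
    [DecidableEq V] [DecidableEq E]
    (T : CirclePacking.Triangulation V E F) (hconn : T.Connected) (hχ : T.eulerChar < 0)
    (Φ : E → ℝ) (hΦ : ∀ e, Φ e ∈ Set.Icc 0 (Real.pi / 2))
    (p : ℝ) (hp : 1 < p) (r₀ : V → ℝ) (hr₀ : ∀ i, 0 < r₀ i) :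
    ∃ r : ℝ → V → ℝ,
      T.IsCalabiFlow Φ p (Set.Ici 0) r ∧ r 0 = r₀ ∧
      (∀ (b : ℝ) (q : ℝ → V → ℝ), 0 < b → T.IsCalabiFlow Φ p (Set.Ico 0 b) q → q 0 = r₀ →
        Set.EqOn q r (Set.Ico 0 b)) ∧
      ((∃ rlim : V → ℝ, (∀ i, 0 < rlim i) ∧ Filter.Tendsto r Filter.atTop (nhds rlim)) ↔
        ∃ rze : V → ℝ, (∀ i, 0 < rze i) ∧ ∀ i, T.curvature Φ rze i = 0) := by
  -- the weights enter all estimates through the sign of their cosines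
  have hcos : ∀ e, 0 ≤ Real.cos (Φ e) := fun e =>
    Real.cos_nonneg_of_mem_Icc ⟨by linarith [(hΦ e).1, Real.pi_pos], (hΦ e).2⟩
  have hφ := CirclePacking.monotone_signedPow hp
  have hφc := CirclePacking.continuous_signedPow hp
  have hφ0 := CirclePacking.signedPow_zero p
  obtain ⟨m, hm, u, hu0, hu⟩ := (T.curvatureSystem Φ hcos).exists_solution_Ici hφ hφc
    (u₀ := fun i => CirclePacking.logCoord (r₀ i)) (fun i => CirclePacking.logCoord_neg (hr₀ i))
  have huX : ∀ t ∈ Set.Ici (0 : ℝ), u t ∈ CirclePacking.negOrthant V := fun t ht i =>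
    ((hu t ht).1 i).trans_lt (neg_lt_zero.2 hm)
  refine ⟨fun t i => CirclePacking.radius (u t i),
    CirclePacking.Triangulation.isCalabiFlow_radius hcos huX fun t ht => (hu t ht).2,
    ?_, ?_, ?_, ?_⟩
  · ext i
    simp only [hu0, CirclePacking.radius_logCoord]
  · intro b q _ hq hq0 t ht
    have hsub : Set.Icc 0 t ⊆ Set.Ico 0 b := fun τ hτ => ⟨hτ.1, hτ.2.trans_lt ht.2⟩
    have heq : (fun i => CirclePacking.logCoord (q t i)) = u t :=
      (T.curvatureSystem Φ hcos).solution_unique hφ hφc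
        (fun τ hτ => (hq.hasDerivWithinAt_logCoord hcos (hsub hτ)).mono hsub)
        (fun τ hτ => (hu τ hτ.1).2.mono fun _ h => h.1)
        (fun τ hτ i => CirclePacking.logCoord_neg (hq τ (hsub hτ) i).1) (fun τ hτ => huX τ hτ.1)
        (by rw [hq0, hu0]) (Set.right_mem_Icc.2 ht.1)
    ext i
    change q t i = CirclePacking.radius (u t i)
    rw [← heq, CirclePacking.radius_logCoord]
  · rintro ⟨rlim, hpos, hlim⟩
    refine ⟨rlim, hpos, ?_⟩
    have hlim' : Filter.Tendsto u Filter.atTop (nhds fun i => CirclePacking.logCoord (rlim i)) := by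
      refine tendsto_pi_nhds.2 fun i => ?_
      have h := (CirclePacking.hasDerivAt_logCoord (hpos i)).continuousAt.tendsto.comp
        (tendsto_pi_nhds.1 hlim i)
      exact h.congr fun t => CirclePacking.logCoord_radius (u t i)
    have h := (T.curvatureSystem Φ hcos).K_eq_zero_of_tendsto hφ hφc hφ0 (fun t ht => (hu t ht).2)
      (fun i => CirclePacking.logCoord_neg (hpos i)) hlim'
    intro i
    have hi := congrFun h i
    simpa only [CirclePacking.Triangulation.curvatureSystem, CirclePacking.radius_logCoord,
      Pi.zero_apply] using hi
  · rintro ⟨rze, hpos, hze⟩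
    have hK : (T.curvatureSystem Φ hcos).K (fun i => CirclePacking.logCoord (rze i)) = 0 := by
      ext i
      simpa only [CirclePacking.Triangulation.curvatureSystem, CirclePacking.radius_logCoord,
        Pi.zero_apply] using hze i
    have hlim := (T.curvatureSystem Φ hcos).tendsto_of_K_eq_zero hφ hφ0 hm hu
      (fun i => CirclePacking.logCoord_neg (hpos i)) hK
    refine ⟨rze, hpos, tendsto_pi_nhds.2 fun i => ?_⟩
    have h := (CirclePacking.hasDerivAt_radius
      (CirclePacking.logCoord_neg (hpos i))).continuousAt.tendsto.comp (tendsto_pi_nhds.1 hlim i)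
    rwa [CirclePacking.radius_logCoord] at h
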